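/- Let $n,m\ge 0$ and let $s_1,\dots,s_{n-1}$ be the adjacent transpositions in $S_n$. Write $w=w_1\cdots w_n\in S_n$ in one-line notation, where an expression $s_{k_1}\cdots s_{k_r}$ for $w$ acts on the word $1\cdots n$ and each generator $s_k$ swaps the letters in positions $k,k+1$ (so $w_a$ is the image of the number $a$ under $s_{k_1}$, then $s_{k_2}$, and so on). Let $\ell(w)$ be the length of $w$ and $e$ the identity. Let $R=\mathbb Z[q^{1/2},q^{-1/2}]$. The Hecke algebra $H_n(q)$ is the $R$-algebra generated by $T_{s_1},\dots,T_{s_{n-1}}$ with relations $T_{s_i}^2=(q-1)T_{s_i}+q$, $T_{s_i}T_{s_j}T_{s_i}=T_{s_j}T_{s_i}T_{s_j}$ for $|i-j|=1$, and $T_{s_i}T_{s_j}=T_{s_j}T_{s_i}$ for $|i-j|\ge2$; put $T_w=T_{s_{k_1}}\cdots T_{s_{k_r}}$ for any reduced expression $s_{k_1}\cdots s_{k_r}$ of $w$. The quantum matrix bialgebra $\mathcal A$ is, as an algebra, the $R$-algebra generated by $x_{i,j}$ ($1\le i,j\le n$) with relations, for $k<l$ and $i<j$, $$x_{i,l}x_{i,k}=q^{1/2}x_{i,k}x_{i,l}\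 (\text{all } i),\qquad x_{j,k}x_{i,k}=q^{1/2}x_{i,k}x_{j,k}\ (\text{all } k),$$ $$x_{j,k}x_{i,l}=x_{i,l}x_{j,k},\qquad x_{j,l}x_{i,k}=x_{i,k}x_{j,l}+(q^{1/2}-q^{-1/2})x_{i,l}x_{j,k}.$$ Its zero-weight space $\mathcal A_0$ is the $R$-span of all $x^{u,v}=x_{u_1,v_1}\cdots x_{u_n,v_n}$, $u,v\in S_n$; it has the $R$-basis $\{x^{e,v}: v\in S_n\}$. For an $R$-linear map $\theta_q:H_n(q)\to R$ put $$\mathrm{Imm}_{\theta_q}(x)=\sum_{w\in S_n}\theta_q(T_w)\,q^{-\ell(w)/2}\,x_{1,w_1}\cdots x_{n,w_n}\in\mathcal A_0 .$$ Let $s_{i_1}\cdots s_{i_m}$ be any (not necessarily reduced) expression, and let $G$ be its wiring diagram, the concatenation from left to right of $m$ elementary diagrams with levels $1,\dots,n$. In the $j$-th one, each level $h\notin\{i_j,i_j+1\}$ carries a horizontal edge of weight $1$, while for $h\in\{i_j,i_j+1\}$ an edge of weight $z_{h,j,1}$ joins the left vertex at level $h$ to a central vertex and an edge of weight $z_{h,j,2}$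 joins the central vertex to the right vertex at level $h$. The weights lie in the $R$-algebra $Z_G$ generated by the $4m$ elements $z_{h,j,k}$, $h\in\{i_j,i_j+1\}$, subject to the relations that $z_{h,j,k}$ and $z_{h',j',k'}$ commute if $j\ne j'$ or $k\ne k'$, and that $$z_{i_j+1,j,k}\,z_{i_j,j,k}=q^{1/2}z_{i_j,j,k}\,z_{i_j+1,j,k}.$$ It has the $R$-basis of monomials in which the weights appear in lexicographic order of $(h,j,k)$; let $z_G$ be the product of all $4m$ weights in lexicographic order, and let $[z_G]f$ be the coefficient of $z_G$ in the expansion of $f\in Z_G$ in this basis. Let $B=(b_{a,c})$ be the weighted path matrix of $G$: $b_{a,c}$ is the sum, over all left-to-right paths in $G$ from source $a$ (left, level $a$) to sink $c$ (right, level $c$), of the products of their edge weights in the order of the path. Let $\sigma_B:\mathcal A_0\to R$ be the $R$-linear map with $$\sigma_B(x^{e,v})=[z_G]\,b_{1,v_1}\cdots b_{n,v_n}\qquad(v\in S_n).$$ Then for every $R$-linear map $\theta_q:H_n(q)\to R$, $$\theta_q\big((1+T_{s_{i_1}})\cdots(1+T_{s_{i_m}})\big)=\sigma_B\big(\mathrm{Imm}_{\theta_q}(x)\big).$$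 -/

import Mathlib

/-! ### Permutations, words in the adjacent transpositions, length -/

namespace QImm

/-- The smaller of the two letters moved by the `k`-th adjacent transposition. -/
def lo {n : ℕ} (k : Fin (n - 1)) : Fin n := ⟨k.1, by omega⟩

/-- The larger of the two letters moved by the `k`-th adjacent transposition. -/
def hi {n : ℕ} (k : Fin (n - 1)) : Fin n := ⟨k.1 + 1, by omega⟩

/-- The adjacent transposition exchanging `lo k` and `hi k`. -/
def adj {n : ℕ} (k : Fin (n - 1)) : Equiv.Perm (Fin n) := Equiv.swap (lo k) (hi k)

/-- The permutation `w` expressed by the word `s_{k₁} ⋯ s_{k_r}`. Its one-line notation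
`w 1, …, w n` is obtained by letting the word act on `1 ⋯ n`, where a generator swaps the letters
in two adjacent *positions*; thus `w a` is the image of `a` under `s_{k₁}`, then `s_{k₂}`, and so
on. -/
def wordPerm {n : ℕ} : List (Fin (n - 1)) → Equiv.Perm (Fin n)
  | [] => 1
  | k :: l => wordPerm l * adj k

/-- A word is reduced if no shorter word expresses the same permutation. -/
def IsReduced {n : ℕ} (l : List (Fin (n - 1))) : Prop :=
  ∀ l' : List (Fin (n - 1)), wordPerm l' = wordPerm l → l.length ≤ l'.length

/-- The number of inversions in the one-line notation. -/
def inv {n : ℕ} (w : Equiv.Perm (Fin n)) : ℕ :=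
  (Finset.univ.filter fun p : Fin n × Fin n => p.1 < p.2 ∧ w p.2 < w p.1).card

theorem lo_lt_hi {n : ℕ} (k : Fin (n - 1)) : lo k < hi k := by
  simp [lo, hi]

theorem adj_lo {n : ℕ} (k : Fin (n - 1)) : adj k (lo k) = hi k := Equiv.swap_apply_left _ _

theorem adj_hi {n : ℕ} (k : Fin (n - 1)) : adj k (hi k) = lo k := Equiv.swap_apply_right _ _

theorem adj_of_ne {n : ℕ} {k : Fin (n - 1)} {a : Fin n} (h₁ : a ≠ lo k) (h₂ : a ≠ hi k) :
    adj k a = a := Equiv.swap_apply_of_ne_of_ne h₁ h₂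

theorem adj_mul_self {n : ℕ} (k : Fin (n - 1)) : adj k * adj k = 1 := Equiv.swap_mul_self _ _

theorem mul_adj_adj {n : ℕ} (w : Equiv.Perm (Fin n)) (k : Fin (n - 1)) :
    w * adj k * adj k = w := by
  rw [mul_assoc, adj_mul_self, mul_one]

theorem adj_val {n : ℕ} (k : Fin (n - 1)) (a : Fin n) :
    (adj k a).1 = if a.1 = k.1 then k.1 + 1 else if a.1 = k.1 + 1 then k.1 else a.1 := by
  unfold adj
  rw [Equiv.swap_apply_def]
  simp only [lo, hi, Fin.ext_iff]
  split_ifs <;> simp_all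

theorem adj_lt_adj {n : ℕ} {k : Fin (n - 1)} {a b : Fin n} (h : a < b)
    (hne : ¬ (a = lo k ∧ b = hi k)) : adj k a < adj k b := by
  rw [Fin.lt_def] at h ⊢
  simp only [Fin.ext_iff, lo, hi] at hne
  rw [adj_val, adj_val]
  split_ifs <;> omega

theorem inv_mul_adj {n : ℕ} {w : Equiv.Perm (Fin n)} {k : Fin (n - 1)}
    (h : w (lo k) < w (hi k)) : inv (w * adj k) = inv w + 1 := by
  classical
  let A := Finset.univ.filter fun p : Fin n × Fin n => p.1 < p.2 ∧ w p.2 < w p.1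
  have hA : (lo k, hi k) ∉ A := by simp [A, h.le]
  let e : Fin n × Fin n ≃ Fin n × Fin n := (adj k).prodCongr (adj k)
  have hee : ∀ a, adj k (adj k a) = a := fun a => by
    rw [← Equiv.Perm.mul_apply, adj_mul_self, Equiv.Perm.one_apply]
  have key : (Finset.univ.filter fun p : Fin n × Fin n =>
      p.1 < p.2 ∧ (w * adj k) p.2 < (w * adj k) p.1)
      = insert (lo k, hi k) (A.map e.toEmbedding) := by
    ext ⟨a, b⟩
    rw [Finset.mem_filter, Finset.mem_insert, Finset.mem_map]
    simp only [Finset.mem_univ, true_and, Equiv.Perm.mul_apply, Prod.mk.injEq]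
    constructor
    · rintro ⟨hab, hw⟩
      by_cases hne : a = lo k ∧ b = hi k
      · exact Or.inl hne
      · refine Or.inr ⟨(adj k a, adj k b), ?_, ?_⟩
        · exact Finset.mem_filter.2 ⟨Finset.mem_univ _, adj_lt_adj hab hne, hw⟩
        · simp [e, hee]
    · rintro (⟨rfl, rfl⟩ | ⟨⟨c, d⟩, hcd, he⟩)
      · exact ⟨lo_lt_hi k, by rw [adj_lo, adj_hi]; exact h⟩
      · simp only [e, Equiv.coe_toEmbedding, Equiv.prodCongr_apply, Prod.map_apply,
          Prod.mk.injEq] at he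
        obtain ⟨rfl, rfl⟩ := he
        obtain ⟨-, hcd, hw⟩ := Finset.mem_filter.1 hcd
        refine ⟨adj_lt_adj hcd ?_, by rw [hee, hee]; exact hw⟩
        rintro ⟨rfl, rfl⟩
        exact absurd hw h.not_gt
  unfold inv
  rw [key, Finset.card_insert_of_notMem, Finset.card_map]
  intro hmem
  rw [Finset.mem_map] at hmem
  obtain ⟨⟨c, d⟩, hc, he⟩ := hmem
  simp only [e, Equiv.coe_toEmbedding, Equiv.prodCongr_apply, Prod.map_apply,
    Prod.mk.injEq] at he
  have h1 : c = hi k := by rw [← hee c, he.1, adj_lo]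
  have h2 : d = lo k := by rw [← hee d, he.2, adj_hi]
  subst h1 h2
  simp only [A, Finset.mem_filter] at hc
  exact absurd hc.2.1 (lo_lt_hi k).not_gt

theorem lt_or_gt_adj {n : ℕ} (w : Equiv.Perm (Fin n)) (k : Fin (n - 1)) :
    w (lo k) < w (hi k) ∨ w (hi k) < w (lo k) :=
  lt_or_gt_of_ne fun h => (lo_lt_hi k).ne (w.injective h)

theorem inv_mul_adj' {n : ℕ} {w : Equiv.Perm (Fin n)} {k : Fin (n - 1)}
    (h : w (hi k) < w (lo k)) : inv w = inv (w * adj k) + 1 := by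
  have h' : (w * adj k) (lo k) < (w * adj k) (hi k) := by
    rw [Equiv.Perm.mul_apply, Equiv.Perm.mul_apply, adj_lo, adj_hi]; exact h
  rw [← inv_mul_adj h', mul_adj_adj]

theorem inv_one {n : ℕ} : inv (1 : Equiv.Perm (Fin n)) = 0 := by
  unfold inv
  rw [Finset.card_eq_zero, Finset.filter_eq_empty_iff]
  rintro p - ⟨h1, h2⟩
  exact absurd h1 h2.not_gt

theorem inv_wordPerm_le {n : ℕ} (l : List (Fin (n - 1))) : inv (wordPerm l) ≤ l.length := by
  induction l with
  | nil => simp [wordPerm, inv_one]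
  | cons k l ih =>
    rw [wordPerm, List.length_cons]
    rcases lt_or_gt_adj (wordPerm l) k with h | h
    · rw [inv_mul_adj h]; omega
    · have := inv_mul_adj' h; omega

theorem exists_descent {n : ℕ} {w : Equiv.Perm (Fin n)} (hw : w ≠ 1) :
    ∃ k : Fin (n - 1), w (hi k) < w (lo k) := by
  by_contra hcon
  push Not at hcon
  apply hw
  have hmono : StrictMono w := by
    cases n with
    | zero => intro a; exact a.elim0
    | succ n =>
      refine Fin.strictMono_iff_lt_succ.2 fun k => ?_
      rcases lt_or_gt_adj w (k : Fin (n + 1 - 1)) with h | h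
      · exact h
      · exact absurd (hcon k) h.not_ge
  have hid : ∀ a, (OrderIso.refl (Fin n)) a = a := fun a => rfl
  have := Subsingleton.elim (hmono.orderIsoOfSurjective w w.surjective) (OrderIso.refl (Fin n))
  ext a
  have h2 := congrArg (fun f : Fin n ≃o Fin n => f a) this
  simpa using congrArg Fin.val h2

theorem exists_word {n : ℕ} (w : Equiv.Perm (Fin n)) :
    ∃ l : List (Fin (n - 1)), wordPerm l = w ∧ l.length = inv w := by
  induction hN : inv w generalizing w with
  | zero =>
    by_cases hw : w = 1
    · exact ⟨[], by simp [wordPerm, hw]⟩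
    · obtain ⟨k, hk⟩ := exists_descent hw
      have := inv_mul_adj' hk; omega
  | succ N ih =>
    have hw : w ≠ 1 := by rintro rfl; rw [inv_one] at hN; omega
    obtain ⟨k, hk⟩ := exists_descent hw
    obtain ⟨l, hl, hlen⟩ := ih (w * adj k) (by have := inv_mul_adj' hk; omega)
    exact ⟨k :: l, by rw [wordPerm, hl, mul_adj_adj], by simp [hlen]⟩

theorem isReduced_iff {n : ℕ} (l : List (Fin (n - 1))) :
    IsReduced l ↔ l.length = inv (wordPerm l) := by
  constructor
  · intro h
    obtain ⟨l', h1, h2⟩ := exists_word (wordPerm l)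
    exact le_antisymm (h2 ▸ h l' h1) (inv_wordPerm_le l)
  · intro h l' h'
    rw [h, ← h']
    exact inv_wordPerm_le l'

theorem exists_reduced {n : ℕ} (w : Equiv.Perm (Fin n)) :
    ∃ l : List (Fin (n - 1)), wordPerm l = w ∧ IsReduced l := by
  obtain ⟨l, h1, h2⟩ := exists_word w
  exact ⟨l, h1, (isReduced_iff l).2 (by rw [h1, h2])⟩

/-- A choice of a reduced expression of `w`. -/
noncomputable def redWord {n : ℕ} (w : Equiv.Perm (Fin n)) : List (Fin (n - 1)) :=
  (exists_reduced w).choose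

theorem wordPerm_redWord {n : ℕ} (w : Equiv.Perm (Fin n)) : wordPerm (redWord w) = w :=
  (exists_reduced w).choose_spec.1

theorem isReduced_redWord {n : ℕ} (w : Equiv.Perm (Fin n)) : IsReduced (redWord w) :=
  (exists_reduced w).choose_spec.2

/-- The length `ℓ(w)`: the number of letters of a reduced expression of `w`. -/
noncomputable def len {n : ℕ} (w : Equiv.Perm (Fin n)) : ℕ := (redWord w).length

theorem len_eq_inv {n : ℕ} (w : Equiv.Perm (Fin n)) : len w = inv w := by
  rw [len, (isReduced_iff _).1 (isReduced_redWord w), wordPerm_redWord]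

theorem adj_comm {n : ℕ} {a b : Fin (n - 1)} (h : a.1 + 2 ≤ b.1 ∨ b.1 + 2 ≤ a.1) :
    adj a * adj b = adj b * adj a := by
  ext x
  simp only [Equiv.Perm.mul_apply, adj_val]
  split_ifs <;> omega

theorem adj_braid {n : ℕ} {a b : Fin (n - 1)} (h : a.1 + 1 = b.1) :
    adj a * adj b * adj a = adj b * adj a * adj b := by
  have e : lo b = hi a := by simp [hi, lo, h]
  have n1 := lo_lt_hi a
  have n2 := lo_lt_hi b
  rw [e] at n2
  have h1 := Equiv.swap_mul_swap_mul_swap n1.ne (n1.trans n2).ne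
  have h2 := Equiv.swap_mul_swap_mul_swap n2.ne' (n1.trans n2).ne'
  unfold adj
  rw [e, h1, Equiv.swap_comm (lo a) (hi a), Equiv.swap_comm (hi a) (hi b), h2,
    Equiv.swap_comm]

/-- The inductive step of Matsumoto's theorem for two words with different first letters. -/
theorem matsumoto_aux {n : ℕ} {M : Type*} [Monoid M] (g : Fin (n - 1) → M)
    (hcomm : ∀ a b : Fin (n - 1), a.1 + 2 ≤ b.1 → g a * g b = g b * g a)
    (hbraid : ∀ a b : Fin (n - 1), a.1 + 1 = b.1 → g a * g b * g a = g b * g a * g b)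
    (w : Equiv.Perm (Fin n))
    (ih : ∀ l l' : List (Fin (n - 1)), l.length + 1 = inv w → l'.length + 1 = inv w →
      inv (wordPerm l) + 1 = inv w → wordPerm l = wordPerm l' →
      (l.map g).prod = (l'.map g).prod)
    (a b : Fin (n - 1)) (l l' : List (Fin (n - 1))) (hab : a.1 < b.1)
    (hl : l.length + 1 = inv w) (hl' : l'.length + 1 = inv w)
    (hwa : wordPerm l = w * adj a) (hwb : wordPerm l' = w * adj b)
    (ha : w (hi a) < w (lo a)) (hb : w (hi b) < w (lo b)) :
    g a * (l.map g).prod = g b * (l'.map g).prod := by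
  have i1 := inv_mul_adj' ha
  have i3 := inv_mul_adj' hb
  rcases Nat.lt_or_ge (a.1 + 1) b.1 with h2 | h2
  · have q1 : adj a (hi b) = hi b := by
      apply adj_of_ne <;> (simp only [lo, hi, ne_eq, Fin.mk.injEq]; omega)
    have q2 : adj a (lo b) = lo b := by
      apply adj_of_ne <;> (simp only [lo, hi, ne_eq, Fin.mk.injEq]; omega)
    have hwab : (w * adj a) (hi b) < (w * adj a) (lo b) := by
      rw [Equiv.Perm.mul_apply, Equiv.Perm.mul_apply, q1, q2]
      exact hb
    have i2 := inv_mul_adj' hwab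
    obtain ⟨r, hr1, hr2⟩ := exists_word (w * adj a * adj b)
    have e1 := ih l (b :: r) hl (by rw [List.length_cons]; omega) (by rw [hwa]; omega)
      (by rw [wordPerm, hr1, mul_adj_adj, hwa])
    have e2 := ih l' (a :: r) hl' (by rw [List.length_cons]; omega) (by rw [hwb]; omega)
      (by rw [wordPerm, hr1, mul_assoc w, adj_comm (Or.inl h2), ← mul_assoc, mul_adj_adj, hwb])
    rw [e1, e2, List.map_cons, List.map_cons, List.prod_cons, List.prod_cons, ← mul_assoc,
      ← mul_assoc, hcomm a b h2]
  · have hab' : a.1 + 1 = b.1 := by omega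
    have e : hi a = lo b := by simp [hi, lo, hab']
    have f1 : adj a (hi b) = hi b := by
      apply adj_of_ne <;> (simp only [lo, hi, ne_eq, Fin.mk.injEq]; omega)
    have f2 : adj b (lo a) = lo a := by
      apply adj_of_ne <;> (simp only [lo, hi, ne_eq, Fin.mk.injEq]; omega)
    have g1 : adj a (lo b) = lo a := by rw [← e, adj_hi]
    have g2 : adj b (hi a) = hi b := by rw [e, adj_lo]
    have hwab : (w * adj a) (hi b) < (w * adj a) (lo b) := by
      rw [Equiv.Perm.mul_apply, Equiv.Perm.mul_apply, f1, g1]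
      exact hb.trans (e ▸ ha)
    have hwaba : (w * adj a * adj b) (hi a) < (w * adj a * adj b) (lo a) := by
      simp only [Equiv.Perm.mul_apply]
      rw [f2, g2, adj_lo, f1, e]
      exact hb
    have i2 := inv_mul_adj' hwab
    have i4 := inv_mul_adj' hwaba
    obtain ⟨r, hr1, hr2⟩ := exists_word (w * adj a * adj b * adj a)
    have e1 := ih l (b :: a :: r) hl (by rw [List.length_cons, List.length_cons]; omega)
      (by rw [hwa]; omega) (by rw [wordPerm, wordPerm, hr1, mul_adj_adj, mul_adj_adj, hwa])
    have e2 := ih l' (a :: b :: r) hl' (by rw [List.length_cons, List.length_cons]; omega)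
      (by rw [hwb]; omega)
      (by
        have : w * adj a * adj b * adj a = w * adj b * adj a * adj b := by
          have := adj_braid hab'
          simp only [mul_assoc] at this ⊢
          rw [this]
        rw [wordPerm, wordPerm, hr1, this, mul_adj_adj, mul_adj_adj, hwb])
    rw [e1, e2]
    simp only [List.map_cons, List.prod_cons, ← mul_assoc]
    rw [hbraid a b hab']

/-- The product of a family satisfying the braid relations along a reduced expression depends
only on the permutation (Matsumoto's theorem for the symmetric group). -/
theorem matsumoto {n : ℕ} {M : Type*} [Monoid M] (g : Fin (n - 1) → M)
    (hcomm : ∀ a b : Fin (n - 1), a.1 + 2 ≤ b.1 → g a * g b = g b * g a)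
    (hbraid : ∀ a b : Fin (n - 1), a.1 + 1 = b.1 → g a * g b * g a = g b * g a * g b)
    {l l' : List (Fin (n - 1))} (hl : IsReduced l) (hl' : IsReduced l')
    (h : wordPerm l = wordPerm l') : (l.map g).prod = (l'.map g).prod := by
  suffices H : ∀ N : ℕ, ∀ l l' : List (Fin (n - 1)), l.length = N → l'.length = N →
      inv (wordPerm l) = N → wordPerm l = wordPerm l' → (l.map g).prod = (l'.map g).prod by
    rw [isReduced_iff] at hl hl'
    exact H _ l l' rfl (by rw [hl', hl, h]) hl.symm h
  clear hl hl' h l l'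
  intro N
  induction N with
  | zero =>
    intro l l' hl hl' _ _
    rw [List.length_eq_zero_iff.1 hl, List.length_eq_zero_iff.1 hl']
  | succ N ih =>
  have desc : ∀ (c : Fin (n - 1)) (r : List (Fin (n - 1))) (w : Equiv.Perm (Fin n)),
      r.length = N → wordPerm r * adj c = w → inv w = N + 1 →
      inv (wordPerm r) = N ∧ w (hi c) < w (lo c) := by
    rintro c r w hr rfl hc
    rcases lt_or_gt_adj (wordPerm r) c with h | h
    · refine ⟨by rw [inv_mul_adj h] at hc; omega, ?_⟩
      simpa only [Equiv.Perm.mul_apply, adj_lo, adj_hi] using h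
    · have := inv_mul_adj' h
      have := inv_wordPerm_le r
      omega
  intro l l' hl hl' hN h
  obtain ⟨a, l, rfl⟩ := List.exists_cons_of_length_eq_add_one hl
  obtain ⟨b, l', rfl⟩ := List.exists_cons_of_length_eq_add_one hl'
  simp only [List.length_cons, Nat.add_right_cancel_iff] at hl hl'
  obtain ⟨w, hw⟩ : ∃ w, wordPerm l * adj a = w := ⟨_, rfl⟩
  have hw' : wordPerm l' * adj b = w := h.symm.trans hw
  have hN' : inv w = N + 1 := by rw [← hw]; exact hN
  obtain ⟨hr, ha⟩ := desc a l w hl hw hN'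
  obtain ⟨hr', hb⟩ := desc b l' w hl' hw' hN'
  have hwa : wordPerm l = w * adj a := by rw [← hw, mul_adj_adj]
  have hwb : wordPerm l' = w * adj b := by rw [← hw', mul_adj_adj]
  rw [List.map_cons, List.map_cons, List.prod_cons, List.prod_cons]
  have ih' : ∀ l l' : List (Fin (n - 1)), l.length + 1 = inv w → l'.length + 1 = inv w →
      inv (wordPerm l) + 1 = inv w → wordPerm l = wordPerm l' →
      (l.map g).prod = (l'.map g).prod := fun l l' h1 h2 h3 h4 =>
    ih l l' (by omega) (by omega) (by omega) h4
  rcases lt_trichotomy a.1 b.1 with hlt | heq | hgt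
  · exact matsumoto_aux g hcomm hbraid w ih' a b l l' hlt (by omega) (by omega) hwa hwb ha hb
  · obtain rfl : a = b := Fin.ext heq
    rw [ih l l' hl hl' hr (by rw [hwa, hwb])]
  · exact (matsumoto_aux g hcomm hbraid w ih' b a l' l hgt (by omega) (by omega)
      hwb hwa hb ha).symm

/-! ### The ground ring and the Hecke algebra -/

/-- The ground ring `ℤ[q^{1/2}, q^{-1/2}]`; its variable is `q^{1/2}`. -/
abbrev Zq : Type := LaurentPolynomial ℤ

/-- The element `q^{k/2}` of the ground ring. -/
noncomputable def qh (k : ℤ) : Zq := LaurentPolynomial.T k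

/-- The defining relations of the Hecke algebra of type `A`. -/
inductive HeckeRel (n : ℕ) :
    FreeAlgebra Zq (Fin (n - 1)) → FreeAlgebra Zq (Fin (n - 1)) → Prop
  | quad (k : Fin (n - 1)) :
      HeckeRel n (FreeAlgebra.ι Zq k * FreeAlgebra.ι Zq k)
        ((qh 2 - 1) • FreeAlgebra.ι Zq k + qh 2 • 1)
  | braid (a b : Fin (n - 1)) (h : a.1 + 1 = b.1 ∨ b.1 + 1 = a.1) :
      HeckeRel n (FreeAlgebra.ι Zq a * FreeAlgebra.ι Zq b * FreeAlgebra.ι Zq a)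
        (FreeAlgebra.ι Zq b * FreeAlgebra.ι Zq a * FreeAlgebra.ι Zq b)
  | comm (a b : Fin (n - 1)) (h : a.1 + 2 ≤ b.1 ∨ b.1 + 2 ≤ a.1) :
      HeckeRel n (FreeAlgebra.ι Zq a * FreeAlgebra.ι Zq b)
        (FreeAlgebra.ι Zq b * FreeAlgebra.ι Zq a)

/-- The Hecke algebra `H_n(q)` of the symmetric group on `n` letters. -/
abbrev Hecke (n : ℕ) : Type := RingQuot (HeckeRel n)

/-- The generator `T_{s_k}` of the Hecke algebra. -/
noncomputable def heckeGen {n : ℕ} (k : Fin (n - 1)) : Hecke n :=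
  RingQuot.mkAlgHom Zq (HeckeRel n) (FreeAlgebra.ι Zq k)

/-- The natural basis element `T_w`: the product of the generators along a reduced expression
of `w`. -/
noncomputable def heckeT {n : ℕ} (w : Equiv.Perm (Fin n)) : Hecke n :=
  ((redWord w).map heckeGen).prod

/-- `T_w` can be computed from any reduced expression of `w`. -/
theorem heckeT_wordPerm {n : ℕ} {l : List (Fin (n - 1))} (hl : IsReduced l) :
    heckeT (wordPerm l) = (l.map heckeGen).prod := by
  refine matsumoto heckeGen ?_ ?_ (isReduced_redWord _) hl (wordPerm_redWord _)
  · intro a b h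
    simp only [heckeGen, ← map_mul]
    exact RingQuot.mkAlgHom_rel Zq (HeckeRel.comm a b (Or.inl h))
  · intro a b h
    simp only [heckeGen, ← map_mul]
    exact RingQuot.mkAlgHom_rel Zq (HeckeRel.braid a b (Or.inl h))

/-! ### The quantum matrix bialgebra and its zero-weight space -/

/-- The generator `x_{i,j}` of the free algebra. -/
noncomputable def xf {n : ℕ} (i j : Fin n) : FreeAlgebra Zq (Fin n × Fin n) :=
  FreeAlgebra.ι Zq (i, j)

/-- The defining relations of the quantum matrix bialgebra, for `i < j` and `k < l`. -/
inductive QMatRel (n : ℕ) :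
    FreeAlgebra Zq (Fin n × Fin n) → FreeAlgebra Zq (Fin n × Fin n) → Prop
  | row (i k l : Fin n) (hkl : k < l) :
      QMatRel n (xf i l * xf i k) (qh 1 • (xf i k * xf i l))
  | col (i j k : Fin n) (hij : i < j) :
      QMatRel n (xf j k * xf i k) (qh 1 • (xf i k * xf j k))
  | anti (i j k l : Fin n) (hij : i < j) (hkl : k < l) :
      QMatRel n (xf j k * xf i l) (xf i l * xf j k)
  | main (i j k l : Fin n) (hij : i < j) (hkl : k < l) :
      QMatRel n (xf j l * xf i k)
        (xf i k * xf j l + (qh 1 - qh (-1)) • (xf i l * xf j k))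

/-- The algebra `A` underlying the `n × n` quantum matrix bialgebra. -/
abbrev QMat (n : ℕ) : Type := RingQuot (QMatRel n)

/-- The generator `x_{i,j}` of the quantum matrix bialgebra. -/
noncomputable def qx {n : ℕ} (i j : Fin n) : QMat n :=
  RingQuot.mkAlgHom Zq (QMatRel n) (xf i j)

/-- The monomial `x^{u,v} = x_{u_1,v_1} ⋯ x_{u_n,v_n}`. -/
noncomputable def xmon {n : ℕ} (u v : Equiv.Perm (Fin n)) : QMat n :=
  (List.ofFn fun a => qx (u a) (v a)).prod

/-- The zero-weight space of `A`: the submodule spanned by all monomials `x^{u,v}`. -/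
noncomputable def zeroWeight (n : ℕ) : Submodule Zq (QMat n) :=
  Submodule.span Zq (Set.range fun p : Equiv.Perm (Fin n) × Equiv.Perm (Fin n) =>
    xmon p.1 p.2)

theorem xmon_mem {n : ℕ} (u v : Equiv.Perm (Fin n)) : xmon u v ∈ zeroWeight n :=
  Submodule.subset_span ⟨(u, v), rfl⟩

theorem ofFn_split {n : ℕ} {X : Type*} (F : Fin n → X) (k : Fin (n - 1)) :
    ∃ p s : List X, p.length = k.1 ∧ ∀ G : Fin n → X,
      (∀ a, a ≠ lo k → a ≠ hi k → G a = F a) →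
      List.ofFn G = p ++ ([G (lo k), G (hi k)] ++ s) := by
  have hk := k.2
  refine ⟨(List.ofFn F).take k.1, (List.ofFn F).drop (k.1 + 2), by simp; omega, ?_⟩
  intro G hG
  apply List.ext_getElem
  · simp; omega
  · intro j h1 h2
    rw [List.length_ofFn] at h1
    rw [List.getElem_ofFn]
    have hl : (List.take k.1 (List.ofFn F)).length = k.1 := by simp; omega
    rcases lt_trichotomy j k.1 with h | h | h
    · rw [List.getElem_append_left (by omega), List.getElem_take, List.getElem_ofFn]
      apply hG <;> (simp only [lo, hi, ne_eq, Fin.mk.injEq]; omega)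
    · rw [List.getElem_append_right (by omega)]
      subst h
      have e : k.1 - (List.take k.1 (List.ofFn F)).length = 0 := by omega
      simp only [e]
      simp [lo]
    · rw [List.getElem_append_right (by omega)]
      rcases Nat.lt_or_ge j (k.1 + 2) with h' | h'
      · obtain rfl : j = k.1 + 1 := by omega
        simp only [hl]
        simp [hi]
      · rw [List.getElem_append_right (by simp; omega), List.getElem_drop, List.getElem_ofFn]
        have e : k.1 + 2 + (j - (List.take k.1 (List.ofFn F)).length -
          [G (lo k), G (hi k)].length) = j := by
          rw [hl]; simp only [List.length_cons, List.length_nil]; omega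
        simp only [e]
        apply hG <;> (simp only [lo, hi, ne_eq, Fin.mk.injEq]; omega)

theorem ofFn_split' {n : ℕ} {X : Type*} {F : Fin n → X} {p s : List X} {x y : X}
    (h : p ++ ([x, y] ++ s) = List.ofFn F) :
    ∃ k : Fin (n - 1), F (lo k) = x ∧ F (hi k) = y ∧ ∀ G : Fin n → X,
      (∀ a, a ≠ lo k → a ≠ hi k → G a = F a) →
      p ++ ([G (lo k), G (hi k)] ++ s) = List.ofFn G := by
  have hlen := congrArg List.length h
  simp only [List.length_append, List.length_cons, List.length_nil, List.length_ofFn] at hlen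
  obtain ⟨p', s', hp, H⟩ := ofFn_split F (⟨p.length, by omega⟩ : Fin (n - 1))
  have h0 := H F (fun _ _ _ => rfl)
  obtain ⟨rfl, h2⟩ := List.append_inj (h.trans h0) hp.symm
  simp only [List.cons_append, List.nil_append, List.cons.injEq] at h2
  obtain ⟨h3, h4, rfl⟩ := h2
  exact ⟨_, h3.symm, h4.symm, fun G hG => (H G hG).symm⟩

/-- The list of index pairs of the monomial `x^{u,v}`. -/
def xword {n : ℕ} (u v : Equiv.Perm (Fin n)) : List (Fin n × Fin n) :=
  List.ofFn fun a => (u a, v a)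

theorem xword_inj {n : ℕ} {u v u' v' : Equiv.Perm (Fin n)} (h : xword u v = xword u' v') :
    u = u' ∧ v = v' := by
  have := List.ofFn_injective h
  constructor <;> ext a
  · exact congrArg (fun z : Fin n × Fin n => z.1.1) (congrFun this a)
  · exact congrArg (fun z : Fin n × Fin n => z.2.1) (congrFun this a)

theorem xword_swap {n : ℕ} {u v : Equiv.Perm (Fin n)} {p s : List (Fin n × Fin n)}
    {i j k l : Fin n} (h : p ++ ([(i, k), (j, l)] ++ s) = xword u v) :
    ∃ c : Fin (n - 1), u (lo c) = i ∧ v (lo c) = k ∧ u (hi c) = j ∧ v (hi c) = l ∧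
      p ++ ([(j, l), (i, k)] ++ s) = xword (u * adj c) (v * adj c) ∧
      p ++ ([(i, l), (j, k)] ++ s) = xword u (v * adj c) := by
  obtain ⟨c, h1, h2, H⟩ := ofFn_split' h
  simp only [Prod.mk.injEq] at h1 h2
  refine ⟨c, h1.1, h1.2, h2.1, h2.2, ?_, ?_⟩
  · have := H (fun a => ((u * adj c) a, (v * adj c) a))
      (fun a ha hb => by simp [adj_of_ne ha hb])
    simpa [adj_lo, adj_hi, h1, h2, xword] using this
  · have := H (fun a => (u a, (v * adj c) a))
      (fun a ha hb => by simp [adj_of_ne ha hb])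
    simpa [adj_lo, adj_hi, h1, h2, xword] using this

/-- An operator on functions on the symmetric group, used to show that the monomials `x^{e,v}`
are linearly independent. -/
noncomputable def kop {n : ℕ} (k : Fin (n - 1)) :
    Module.End Zq (Equiv.Perm (Fin n) → Zq) where
  toFun c v := c (v * adj k) + (if v (hi k) < v (lo k) then qh 1 - qh (-1) else 0) * c v
  map_add' c d := by ext1 v; simp only [Pi.add_apply]; ring
  map_smul' r c := by ext1 v; simp only [Pi.smul_apply, smul_eq_mul, RingHom.id_apply]; ring

theorem kop_apply {n : ℕ} (k : Fin (n - 1)) (c : Equiv.Perm (Fin n) → Zq)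
    (v : Equiv.Perm (Fin n)) : kop k c v =
      c (v * adj k) + (if v (hi k) < v (lo k) then qh 1 - qh (-1) else 0) * c v := rfl

theorem kop_comm {n : ℕ} (a b : Fin (n - 1)) (h : a.1 + 2 ≤ b.1) :
    kop (n := n) a * kop b = kop b * kop a := by
  have q1 : adj a (hi b) = hi b := by
    apply adj_of_ne <;> (simp only [lo, hi, ne_eq, Fin.mk.injEq]; omega)
  have q2 : adj a (lo b) = lo b := by
    apply adj_of_ne <;> (simp only [lo, hi, ne_eq, Fin.mk.injEq]; omega)
  have q3 : adj b (hi a) = hi a := by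
    apply adj_of_ne <;> (simp only [lo, hi, ne_eq, Fin.mk.injEq]; omega)
  have q4 : adj b (lo a) = lo a := by
    apply adj_of_ne <;> (simp only [lo, hi, ne_eq, Fin.mk.injEq]; omega)
  refine LinearMap.ext fun c => funext fun v => ?_
  simp only [Module.End.mul_apply, kop_apply, Equiv.Perm.mul_apply, q1, q2, q3, q4]
  rw [mul_assoc v, adj_comm (Or.inl h), ← mul_assoc]
  ring

theorem kop_braid {n : ℕ} (a b : Fin (n - 1)) (h : a.1 + 1 = b.1) :
    kop (n := n) a * kop b * kop a = kop b * kop a * kop b := by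
  have e : hi a = lo b := by simp [hi, lo, h]
  have f1 : adj a (hi b) = hi b := by
    apply adj_of_ne <;> (simp only [lo, hi, ne_eq, Fin.mk.injEq]; omega)
  have f2 : adj b (lo a) = lo a := by
    apply adj_of_ne <;> (simp only [lo, hi, ne_eq, Fin.mk.injEq]; omega)
  have g1 : adj a (lo b) = lo a := by rw [← e, adj_hi]
  have g3 : adj a (lo a) = lo b := by rw [← e, adj_lo]
  have g2 : adj b (lo b) = hi b := adj_lo b
  have g4 : adj b (hi b) = lo b := adj_hi b
  refine LinearMap.ext fun c => funext fun v => ?_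
  have hb : v * adj a * adj b * adj a = v * adj b * adj a * adj b := by
    have := adj_braid h
    simp only [mul_assoc] at this ⊢
    rw [this]
  simp only [Module.End.mul_apply, kop_apply, Equiv.Perm.mul_apply, e, f1, f2, g1, g2, g3, g4,
    hb, mul_adj_adj]
  have h1 : v (lo a) ≠ v (lo b) := fun hh => (lo_lt_hi a).ne (e ▸ v.injective hh)
  have h2 : v (lo b) ≠ v (hi b) := fun hh => (lo_lt_hi b).ne (v.injective hh)
  have h3 : v (lo a) ≠ v (hi b) := fun hh => by
    have := lo_lt_hi a
    rw [v.injective hh, e] at this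
    exact absurd this (lo_lt_hi b).not_gt
  rcases lt_or_gt_of_ne h1 with i1 | i1 <;> rcases lt_or_gt_of_ne h2 with i2 | i2 <;>
    rcases lt_or_gt_of_ne h3 with i3 | i3 <;>
    first
    | exact absurd (i1.trans i2) i3.not_gt
    | exact absurd (i2.trans i1) i3.not_gt
    | (simp only [i1, i2, i3, i1.not_gt, i2.not_gt, i3.not_gt, if_true, if_false]; ring)

/-- The coefficient of the functional with prescribed values `f v` on `x^{e,v}` at `x^{u,v}`. -/
noncomputable def xcoef {n : ℕ} (f : Equiv.Perm (Fin n) → Zq) (u : Equiv.Perm (Fin n)) :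
    Equiv.Perm (Fin n) → Zq :=
  ((redWord u).map kop).prod f

theorem xcoef_one {n : ℕ} (f : Equiv.Perm (Fin n) → Zq) : xcoef f 1 = f := by
  have h : (redWord (1 : Equiv.Perm (Fin n))).length = 0 := by
    rw [← len, len_eq_inv, inv_one]
  rw [xcoef, List.length_eq_zero_iff.1 h]
  rfl

theorem xcoef_mul_adj {n : ℕ} (f : Equiv.Perm (Fin n) → Zq) {u : Equiv.Perm (Fin n)}
    {k : Fin (n - 1)} (h : u (lo k) < u (hi k)) :
    xcoef f (u * adj k) = kop k (xcoef f u) := by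
  have hred : IsReduced (k :: redWord u) := by
    rw [isReduced_iff, wordPerm, wordPerm_redWord, inv_mul_adj h, List.length_cons,
      ← len, len_eq_inv]
  have := matsumoto kop kop_comm kop_braid (isReduced_redWord (u * adj k)) hred
    (by rw [wordPerm_redWord, wordPerm, wordPerm_redWord])
  rw [xcoef, this]
  rfl

open Classical in
/-- The value of the functional on an arbitrary word. -/
noncomputable def wcoef {n : ℕ} (f : Equiv.Perm (Fin n) → Zq) (L : List (Fin n × Fin n)) : Zq :=
  if h : ∃ p : Equiv.Perm (Fin n) × Equiv.Perm (Fin n), L = xword p.1 p.2 then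
    xcoef f h.choose.1 h.choose.2 else 0

theorem wcoef_xword {n : ℕ} (f : Equiv.Perm (Fin n) → Zq) {L : List (Fin n × Fin n)}
    {u v : Equiv.Perm (Fin n)} (hL : L = xword u v) : wcoef f L = xcoef f u v := by
  have h : ∃ p : Equiv.Perm (Fin n) × Equiv.Perm (Fin n), L = xword p.1 p.2 := ⟨(u, v), hL⟩
  obtain ⟨h1, h2⟩ := xword_inj (h.choose_spec.symm.trans hL)
  rw [wcoef, dif_pos h, h1, h2]

theorem wcoef_eq_zero {n : ℕ} (f : Equiv.Perm (Fin n) → Zq) {L : List (Fin n × Fin n)}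
    (hL : ∀ u v, L ≠ xword u v) : wcoef f L = 0 := by
  rw [wcoef, dif_neg]
  rintro ⟨p, hp⟩
  exact hL _ _ hp

theorem wcoef_row {n : ℕ} (f : Equiv.Perm (Fin n) → Zq) (p s : List (Fin n × Fin n))
    (i k l : Fin n) : wcoef f (p ++ ([(i, k), (i, l)] ++ s)) = 0 := by
  refine wcoef_eq_zero f fun u v h => ?_
  obtain ⟨c, h1, -, h3, -⟩ := xword_swap h
  exact (lo_lt_hi c).ne (u.injective (h1.trans h3.symm))

theorem wcoef_col {n : ℕ} (f : Equiv.Perm (Fin n) → Zq) (p s : List (Fin n × Fin n))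
    (i j k : Fin n) : wcoef f (p ++ ([(i, k), (j, k)] ++ s)) = 0 := by
  refine wcoef_eq_zero f fun u v h => ?_
  obtain ⟨c, -, h1, -, h3, -⟩ := xword_swap h
  exact (lo_lt_hi c).ne (v.injective (h1.trans h3.symm))

theorem wcoef_anti {n : ℕ} (f : Equiv.Perm (Fin n) → Zq) (p s : List (Fin n × Fin n))
    (i j k l : Fin n) (hij : i < j) (hkl : k < l) :
    wcoef f (p ++ ([(j, k), (i, l)] ++ s)) = wcoef f (p ++ ([(i, l), (j, k)] ++ s)) := by
  by_cases h : ∃ u v, p ++ ([(i, l), (j, k)] ++ s) = xword u v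
  · obtain ⟨u, v, h⟩ := h
    obtain ⟨c, h1, h2, h3, h4, h5, h6⟩ := xword_swap h
    rw [wcoef_xword f h, wcoef_xword f h5, xcoef_mul_adj f (by rw [h1, h3]; exact hij),
      kop_apply, mul_adj_adj, Equiv.Perm.mul_apply, Equiv.Perm.mul_apply, adj_lo, adj_hi,
      h2, h4, if_neg hkl.not_gt, zero_mul, add_zero]
  · push Not at h
    rw [wcoef_eq_zero f h, wcoef_eq_zero]
    intro u v h'
    obtain ⟨c, -, -, -, -, h5, -⟩ := xword_swap h'
    exact h _ _ h5

theorem wcoef_main {n : ℕ} (f : Equiv.Perm (Fin n) → Zq) (p s : List (Fin n × Fin n))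
    (i j k l : Fin n) (hij : i < j) (hkl : k < l) :
    wcoef f (p ++ ([(j, l), (i, k)] ++ s)) = wcoef f (p ++ ([(i, k), (j, l)] ++ s)) +
      (qh 1 - qh (-1)) * wcoef f (p ++ ([(i, l), (j, k)] ++ s)) := by
  by_cases h : ∃ u v, p ++ ([(i, k), (j, l)] ++ s) = xword u v
  · obtain ⟨u, v, h⟩ := h
    obtain ⟨c, h1, h2, h3, h4, h5, h6⟩ := xword_swap h
    rw [wcoef_xword f h, wcoef_xword f h5, wcoef_xword f h6,
      xcoef_mul_adj f (by rw [h1, h3]; exact hij),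
      kop_apply, mul_adj_adj, Equiv.Perm.mul_apply, Equiv.Perm.mul_apply, adj_lo, adj_hi,
      h2, h4, if_pos hkl]
  · push Not at h
    rw [wcoef_eq_zero f h, wcoef_eq_zero, wcoef_eq_zero, mul_zero, add_zero]
    · intro u v h'
      obtain ⟨c, -, -, -, -, -, h6⟩ := xword_swap h'
      exact h _ _ h6
    · intro u v h'
      obtain ⟨c, -, -, -, -, h5, -⟩ := xword_swap h'
      exact h _ _ h5

/-- The functional on the free algebra given by `wcoef` on words. -/
noncomputable def xfun {n : ℕ} (f : Equiv.Perm (Fin n) → Zq) :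
    FreeAlgebra Zq (Fin n × Fin n) →ₗ[Zq] Zq :=
  (FreeAlgebra.basisFreeMonoid Zq (Fin n × Fin n)).constr Zq
    fun L => wcoef f (FreeMonoid.toList L)

theorem basisFreeMonoid_eq {X : Type} (L : FreeMonoid X) :
    FreeAlgebra.basisFreeMonoid Zq X L = ((FreeMonoid.toList L).map (FreeAlgebra.ι Zq)).prod := by
  simp [FreeAlgebra.basisFreeMonoid, FreeAlgebra.equivMonoidAlgebraFreeMonoid,
    FreeMonoid.lift_apply]

theorem xfun_prod {n : ℕ} (f : Equiv.Perm (Fin n) → Zq) (L : List (Fin n × Fin n)) :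
    xfun f ((L.map (FreeAlgebra.ι Zq)).prod) = wcoef f L := by
  have := basisFreeMonoid_eq (FreeMonoid.ofList L)
  rw [FreeMonoid.toList_ofList] at this
  rw [← this, xfun, Module.Basis.constr_basis, FreeMonoid.toList_ofList]

theorem xfun_rel {n : ℕ} (f : Equiv.Perm (Fin n) → Zq)
    {a b : FreeAlgebra Zq (Fin n × Fin n)} (h : QMatRel n a b)
    (p s : FreeAlgebra Zq (Fin n × Fin n)) : xfun f (p * a * s) = xfun f (p * b * s) := by
  have step : ∀ P S : List (Fin n × Fin n),
      xfun f ((P.map (FreeAlgebra.ι Zq)).prod * a * (S.map (FreeAlgebra.ι Zq)).prod) =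
      xfun f ((P.map (FreeAlgebra.ι Zq)).prod * b * (S.map (FreeAlgebra.ι Zq)).prod) := by
    intro P S
    have key : ∀ i j k l : Fin n,
        xfun f ((P.map (FreeAlgebra.ι Zq)).prod * (xf i j * xf k l) *
          (S.map (FreeAlgebra.ι Zq)).prod) = wcoef f (P ++ ([(i, j), (k, l)] ++ S)) := by
      intro i j k l
      rw [← xfun_prod]
      simp [xf, mul_assoc]
    cases h with
    | row i k l hkl =>
      rw [mul_smul_comm, smul_mul_assoc, map_smul, key, key, wcoef_row, wcoef_row, smul_zero]
    | col i j k hij =>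
      rw [mul_smul_comm, smul_mul_assoc, map_smul, key, key, wcoef_col, wcoef_col, smul_zero]
    | anti i j k l hij hkl => rw [key, key, wcoef_anti f P S i j k l hij hkl]
    | main i j k l hij hkl =>
      rw [mul_add, add_mul, map_add, mul_smul_comm, smul_mul_assoc, map_smul, key, key, key,
        wcoef_main f P S i j k l hij hkl, smul_eq_mul]
  have h1 : ∀ (S : List (Fin n × Fin n)) (p : FreeAlgebra Zq (Fin n × Fin n)),
      xfun f (p * a * (S.map (FreeAlgebra.ι Zq)).prod) =
      xfun f (p * b * (S.map (FreeAlgebra.ι Zq)).prod) := by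
    intro S p
    have : (xfun f) ∘ₗ LinearMap.mulRight Zq (a * (S.map (FreeAlgebra.ι Zq)).prod) =
        (xfun f) ∘ₗ LinearMap.mulRight Zq (b * (S.map (FreeAlgebra.ι Zq)).prod) := by
      refine (FreeAlgebra.basisFreeMonoid Zq (Fin n × Fin n)).ext fun L => ?_
      rw [basisFreeMonoid_eq]
      have h2 := step (FreeMonoid.toList L) S
      simpa only [LinearMap.comp_apply, LinearMap.mulRight_apply, mul_assoc] using h2
    have h2 := LinearMap.congr_fun this p
    simpa only [LinearMap.comp_apply, LinearMap.mulRight_apply, ← mul_assoc] using h2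
  have : (xfun f) ∘ₗ LinearMap.mulLeft Zq (p * a) = (xfun f) ∘ₗ LinearMap.mulLeft Zq (p * b) := by
    refine (FreeAlgebra.basisFreeMonoid Zq (Fin n × Fin n)).ext fun L => ?_
    rw [basisFreeMonoid_eq]
    simpa only [LinearMap.comp_apply, LinearMap.mulLeft_apply] using h1 (FreeMonoid.toList L) p
  exact LinearMap.congr_fun this s

theorem xfun_congr {n : ℕ} (f : Equiv.Perm (Fin n) → Zq)
    {a b : FreeAlgebra Zq (Fin n × Fin n)}
    (h : RingQuot.mkAlgHom Zq (QMatRel n) a = RingQuot.mkAlgHom Zq (QMatRel n) b) :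
    xfun f a = xfun f b := by
  have h' : RingQuot.mkRingHom (QMatRel n) a = RingQuot.mkRingHom (QMatRel n) b := by
    rw [← RingQuot.mkAlgHom_coe Zq]; exact h
  have h2 : Relation.EqvGen (RingQuot.Rel (QMatRel n)) a b := by
    simp only [RingQuot.mkRingHom_def, RingHom.coe_mk, MonoidHom.coe_mk, OneHom.coe_mk,
      RingQuot.mk.injEq] at h'
    exact Quot.eqvGen_exact h'
  have h3 : ∀ a b, RingQuot.Rel (QMatRel n) a b →
      ∀ p s, xfun f (p * a * s) = xfun f (p * b * s) := by
    intro a b hab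
    induction hab with
    | of h => exact xfun_rel f h
    | add_left _ ih => intro p s; simp only [mul_add, add_mul, map_add, ih]
    | @mul_left a b c _ ih =>
      intro p s
      have := ih p (c * s)
      simpa only [mul_assoc] using this
    | @mul_right a b c _ ih =>
      intro p s
      have := ih (p * a) s
      simpa only [mul_assoc] using this
  clear h h'
  induction h2 with
  | rel a b h => simpa using h3 a b h 1 1
  | refl => rfl
  | symm _ _ _ ih => exact ih.symm
  | trans _ _ _ _ _ ih1 ih2 => exact ih1.trans ih2

theorem xmon_eq_mk {n : ℕ} (u v : Equiv.Perm (Fin n)) :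
    xmon u v = RingQuot.mkAlgHom Zq (QMatRel n)
      (((xword u v).map (FreeAlgebra.ι Zq)).prod) := by
  rw [map_list_prod, xword, List.map_map, List.map_ofFn, xmon]
  rfl

theorem linearIndependent_xmon {n : ℕ} :
    LinearIndependent Zq fun v : Equiv.Perm (Fin n) => xmon 1 v := by
  classical
  rw [Fintype.linearIndependent_iffₛ]
  intro c d hc w
  simp only [xmon_eq_mk, ← map_smul, ← map_sum] at hc
  have := xfun_congr (Pi.single w 1) hc
  simpa [xfun_prod, wcoef_xword _ rfl, xcoef_one, Pi.single_apply] using this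

theorem xmon_split {n : ℕ} (u v : Equiv.Perm (Fin n)) (c : Fin (n - 1)) :
    ∃ p s : QMat n,
      xmon u v = p * (qx (u (lo c)) (v (lo c)) * qx (u (hi c)) (v (hi c))) * s ∧
      xmon (u * adj c) (v * adj c) =
        p * (qx (u (hi c)) (v (hi c)) * qx (u (lo c)) (v (lo c))) * s ∧
      xmon u (v * adj c) = p * (qx (u (lo c)) (v (hi c)) * qx (u (hi c)) (v (lo c))) * s := by
  obtain ⟨p, s, -, H⟩ := ofFn_split (fun a => (u a, v a)) c
  have key : ∀ u' v' : Equiv.Perm (Fin n),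
      (∀ a, a ≠ lo c → a ≠ hi c → (u' a, v' a) = (u a, v a)) →
      xmon u' v' = (p.map fun z => qx z.1 z.2).prod *
        (qx (u' (lo c)) (v' (lo c)) * qx (u' (hi c)) (v' (hi c))) *
        (s.map fun z => qx z.1 z.2).prod := by
    intro u' v' h
    have h2 : xmon u' v' = ((List.ofFn fun a => (u' a, v' a)).map fun z => qx z.1 z.2).prod := by
      rw [List.map_ofFn]; rfl
    rw [h2, H _ h]
    simp [mul_assoc]
  refine ⟨_, _, key u v fun _ _ _ => rfl, ?_, ?_⟩
  · rw [key (u * adj c) (v * adj c) fun a ha hb => by simp [adj_of_ne ha hb]]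
    simp [adj_lo, adj_hi]
  · rw [key u (v * adj c) fun a ha hb => by simp [adj_of_ne ha hb]]
    simp [adj_lo, adj_hi]

theorem xmon_mem_span {n : ℕ} (u v : Equiv.Perm (Fin n)) :
    xmon u v ∈ Submodule.span Zq (Set.range fun w : Equiv.Perm (Fin n) => xmon 1 w) := by
  induction hN : inv u generalizing u v with
  | zero =>
    by_cases hu : u = 1
    · exact hu ▸ Submodule.subset_span ⟨v, rfl⟩
    · obtain ⟨k, hk⟩ := exists_descent hu
      have := inv_mul_adj' hk; omega
  | succ N ih =>
    have hu : u ≠ 1 := by rintro rfl; rw [inv_one] at hN; omega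
    obtain ⟨c, hc⟩ := exists_descent hu
    have hinv := inv_mul_adj' hc
    obtain ⟨p, s, h1, h2, h3⟩ := xmon_split (u * adj c) (v * adj c) c
    rw [mul_adj_adj, mul_adj_adj] at h2
    rw [mul_adj_adj] at h3
    have m1 := ih (u * adj c) (v * adj c) (by omega)
    have m2 := ih (u * adj c) v (by omega)
    have hlt : (u * adj c) (lo c) < (u * adj c) (hi c) := by
      simpa [adj_lo, adj_hi] using hc
    rcases lt_or_gt_adj (v * adj c) c with hv | hv
    · have r := RingQuot.mkAlgHom_rel Zq (QMatRel.main _ _ _ _ hlt hv)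
      simp only [map_mul, map_add, map_smul, ← qx.eq_def] at r
      rw [h2, r, mul_add, add_mul, mul_smul_comm, smul_mul_assoc, ← h1, ← h3]
      exact Submodule.add_mem _ m1 (Submodule.smul_mem _ _ m2)
    · have r := RingQuot.mkAlgHom_rel Zq (QMatRel.anti _ _ _ _ hlt hv)
      simp only [map_mul, ← qx.eq_def] at r
      rw [h2, r, ← h1]
      exact m1

/-- The natural basis `{x^{e,v}}` of the zero-weight space. -/
noncomputable def zwBasis (n : ℕ) : Module.Basis (Equiv.Perm (Fin n)) Zq (zeroWeight n) :=
  Module.Basis.mk (v := fun v => (⟨xmon 1 v, xmon_mem 1 v⟩ : zeroWeight n))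
    (LinearIndependent.of_comp (zeroWeight n).subtype linearIndependent_xmon)
    (by
      rintro ⟨y, hy⟩ -
      have h1 : zeroWeight n ≤
          Submodule.span Zq (Set.range fun w : Equiv.Perm (Fin n) => xmon 1 w) := by
        rw [zeroWeight, Submodule.span_le]
        rintro _ ⟨p, rfl⟩
        exact xmon_mem_span _ _
      have h2 := h1 hy
      have h3 : (Set.range fun w : Equiv.Perm (Fin n) => xmon 1 w) =
          (zeroWeight n).subtype ''
            Set.range fun w : Equiv.Perm (Fin n) => (⟨xmon 1 w, xmon_mem 1 w⟩ : zeroWeight n) := by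
        rw [← Set.range_comp]; rfl
      rw [h3, Submodule.span_image] at h2
      obtain ⟨z, hz, hzy⟩ := h2
      obtain rfl : z = ⟨y, hy⟩ := Subtype.ext hzy
      exact hz)

theorem zwBasis_apply {n : ℕ} (v : Equiv.Perm (Fin n)) :
    (zwBasis n v : QMat n) = xmon 1 v := by
  simp [zwBasis]

/-! ### Wiring diagrams and their quasi-commuting weights

The wiring diagram of `s_{i_1} ⋯ s_{i_m}` is the concatenation of `m` elementary diagrams. The
`j`-th one has horizontal edges at the levels different from `lo (i j)` and `hi (i j)`, and four
further edges, which join the left and right vertices of these two levels to a central vertex. -/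

/-- The level `h` is one of the two levels that meet at the central vertex of the diagram of the
`k`-th generator. -/
def OnCross {n : ℕ} (k : Fin (n - 1)) (h : Fin n) : Prop := h = lo k ∨ h = hi k

instance {n : ℕ} (k : Fin (n - 1)) (h : Fin n) : Decidable (OnCross k h) :=
  inferInstanceAs (Decidable (h = lo k ∨ h = hi k))

/-- The indices `(h, j, k)` of the edge weights `z_{h,j,k}`, in lexicographic order. The edges at
the left and the right of the central vertex have `k = 0` and `k = 1`, respectively. -/
abbrev ZIndex {n m : ℕ} (i : Fin m → Fin (n - 1)) : Type :=
  {a : Fin n ×ₗ (Fin m ×ₗ Fin 2) // OnCross (i (ofLex (ofLex a).2).1) (ofLex a).1}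

noncomputable instance {n m : ℕ} (i : Fin m → Fin (n - 1)) : Fintype (ZIndex i) :=
  haveI : Finite (Fin n ×ₗ (Fin m ×ₗ Fin 2)) :=
    inferInstanceAs (Finite (Fin n × (Fin m × Fin 2)))
  Fintype.ofFinite _

/-- The level `h` of the index `(h, j, k)`. -/
def ZIndex.lev {n m : ℕ} {i : Fin m → Fin (n - 1)} (a : ZIndex i) : Fin n := (ofLex a.1).1

/-- The position `j` of the index `(h, j, k)`. -/
def ZIndex.pos {n m : ℕ} {i : Fin m → Fin (n - 1)} (a : ZIndex i) : Fin m :=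
  (ofLex (ofLex a.1).2).1

/-- The side `k` of the index `(h, j, k)`. -/
def ZIndex.side {n m : ℕ} {i : Fin m → Fin (n - 1)} (a : ZIndex i) : Fin 2 :=
  (ofLex (ofLex a.1).2).2

/-- The commutation and quasi-commutation relations between the weights. -/
inductive ZRel {n m : ℕ} (i : Fin m → Fin (n - 1)) :
    FreeAlgebra Zq (ZIndex i) → FreeAlgebra Zq (ZIndex i) → Prop
  | comm (a b : ZIndex i) (h : a.pos ≠ b.pos ∨ a.side ≠ b.side) :
      ZRel i (FreeAlgebra.ι Zq a * FreeAlgebra.ι Zq b)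
        (FreeAlgebra.ι Zq b * FreeAlgebra.ι Zq a)
  | quasi (a b : ZIndex i) (hp : a.pos = b.pos) (hs : a.side = b.side)
      (ha : a.lev = lo (i a.pos)) (hb : b.lev = hi (i b.pos)) :
      ZRel i (FreeAlgebra.ι Zq b * FreeAlgebra.ι Zq a)
        (qh 1 • (FreeAlgebra.ι Zq a * FreeAlgebra.ι Zq b))

/-- The ring `Z_G` of quasi-commuting edge weights. -/
abbrev ZG {n m : ℕ} (i : Fin m → Fin (n - 1)) : Type := RingQuot (ZRel i)

/-- The weight `z_a` of the edge with index `a`. -/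
noncomputable def zgen {n m : ℕ} {i : Fin m → Fin (n - 1)} (a : ZIndex i) : ZG i :=
  RingQuot.mkAlgHom Zq (ZRel i) (FreeAlgebra.ι Zq a)

/-- The monomial with exponent vector `α` in the weights, in lexicographic order. -/
noncomputable def zmono {n m : ℕ} {i : Fin m → Fin (n - 1)} (α : ZIndex i → ℕ) : ZG i :=
  (((Finset.univ : Finset (ZIndex i)).sort (· ≤ ·)).map fun a => zgen a ^ α a).prod

/-- The exponent of `q^{1/2}` that arises from moving the weight of index `b` to the right of
the weight of index `a`, when `a` precedes `b`. -/
def zexp {n m : ℕ} {i : Fin m → Fin (n - 1)} (a b : ZIndex i) : ℤ :=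
  if a.pos = b.pos ∧ a.side = b.side ∧ a.lev < b.lev then 1 else 0

theorem ZIndex.lev_cases {n m : ℕ} {i : Fin m → Fin (n - 1)} (a : ZIndex i) :
    a.lev = lo (i a.pos) ∨ a.lev = hi (i a.pos) := a.2

theorem ZIndex.lev_le {n m : ℕ} {i : Fin m → Fin (n - 1)} {a b : ZIndex i} (h : a < b) :
    a.lev ≤ b.lev := by
  have h' : a.1 < b.1 := h
  rw [Prod.Lex.lt_iff] at h'
  rcases h' with h | h
  · exact h.le
  · exact h.1.le

theorem ZIndex.lev_lt {n m : ℕ} {i : Fin m → Fin (n - 1)} {a b : ZIndex i} (h : a < b)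
    (hp : a.pos = b.pos) (hs : a.side = b.side) : a.lev < b.lev := by
  refine lt_of_le_of_ne (ZIndex.lev_le h) fun hl => h.ne ?_
  exact Subtype.ext (Prod.ext hl (Prod.ext hp hs))

theorem ZIndex.lt_of_lev_lt {n m : ℕ} {i : Fin m → Fin (n - 1)} {a b : ZIndex i}
    (h : a.lev < b.lev) : a < b := by
  have : a.1 < b.1 := by
    rw [Prod.Lex.lt_iff]
    exact Or.inl h
  exact this

theorem zgen_swap {n m : ℕ} {i : Fin m → Fin (n - 1)} {a b : ZIndex i} (h : a < b) :
    zgen b * zgen a = qh (zexp a b) • (zgen a * zgen b) := by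
  unfold zexp
  by_cases hps : a.pos = b.pos ∧ a.side = b.side
  · obtain ⟨hp, hs⟩ := hps
    have hl := ZIndex.lev_lt h hp hs
    rw [if_pos ⟨hp, hs, hl⟩]
    have ha := a.lev_cases
    have hb := b.lev_cases
    have hlt := lo_lt_hi (i a.pos)
    have r : ZRel i _ _ := ZRel.quasi a b hp hs
      (by
        rcases ha with ha | ha
        · exact ha
        · rcases hb with hb | hb <;> rw [ha, hb, ← hp] at hl
          · exact absurd hl hlt.not_gt
          · exact absurd hl (lt_irrefl _))
      (by
        rcases hb with hb | hb
        · rcases ha with ha | ha <;> rw [ha, hb, ← hp] at hl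
          · exact absurd hl (lt_irrefl _)
          · exact absurd hl hlt.not_gt
        · exact hb)
    have := RingQuot.mkAlgHom_rel Zq r
    simpa only [map_mul, map_smul, ← zgen.eq_def] using this
  · rw [if_neg fun hh => hps ⟨hh.1, hh.2.1⟩]
    have r : ZRel i _ _ := ZRel.comm b a (by
      by_contra hcon
      push Not at hcon
      exact hps ⟨hcon.1.symm, hcon.2.symm⟩)
    have := RingQuot.mkAlgHom_rel Zq r
    simp only [map_mul] at this
    rw [qh, LaurentPolynomial.T_zero, one_smul]
    exact this

theorem zgen_swap_pow {n m : ℕ} {i : Fin m → Fin (n - 1)} {a b : ZIndex i} (h : a < b) (k : ℕ) :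
    ∃ c : Zq, zgen b * zgen a ^ k = c • (zgen a ^ k * zgen b) := by
  induction k with
  | zero => exact ⟨1, by simp⟩
  | succ k ih =>
    obtain ⟨c, hc⟩ := ih
    refine ⟨c * qh (zexp a b), ?_⟩
    rw [pow_succ, ← mul_assoc, hc, smul_mul_assoc, mul_assoc, zgen_swap h, mul_smul_comm,
      smul_smul, ← mul_assoc]

theorem zgen_mul_list {n m : ℕ} {i : Fin m → Fin (n - 1)} (b : ZIndex i) (α : ZIndex i → ℕ)
    (L : List (ZIndex i)) (hL : L.Pairwise (· < ·)) (hb : b ∈ L) :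
    ∃ c : Zq, zgen b * (L.map fun a => zgen a ^ α a).prod =
      c • (L.map fun a => zgen a ^ (α + Pi.single b 1 : ZIndex i → ℕ) a).prod := by
  induction L with
  | nil => simp at hb
  | cons a L ih =>
    rw [List.pairwise_cons] at hL
    rw [List.map_cons, List.prod_cons, List.map_cons, List.prod_cons]
    by_cases hab : b = a
    · subst hab
      refine ⟨1, ?_⟩
      have : (L.map fun a => zgen a ^ (α + Pi.single b 1 : ZIndex i → ℕ) a) = L.map fun a => zgen a ^ α a := by
        refine List.map_congr_left fun c hc => ?_
        simp [Pi.single_eq_of_ne (hL.1 c hc).ne']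
      rw [this, one_smul, ← mul_assoc, Pi.add_apply, Pi.single_eq_same, pow_succ']
    · have hbL : b ∈ L := (List.mem_cons.1 hb).resolve_left hab
      obtain ⟨c, hc⟩ := ih hL.2 hbL
      obtain ⟨d, hd⟩ := zgen_swap_pow (hL.1 b hbL) (α a)
      refine ⟨d * c, ?_⟩
      rw [← mul_assoc, hd, smul_mul_assoc, mul_assoc, hc, mul_smul_comm, smul_smul,
        Pi.add_apply, Pi.single_eq_of_ne (Ne.symm hab), add_zero]

theorem zmono_span {n m : ℕ} (i : Fin m → Fin (n - 1)) :
    (⊤ : Submodule Zq (ZG i)) ≤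
      Submodule.span Zq (Set.range fun α : ZIndex i → ℕ => zmono α) := by
  have hgen : ∀ (b : ZIndex i) (y : ZG i),
      y ∈ Submodule.span Zq (Set.range fun α : ZIndex i → ℕ => zmono α) →
      zgen b * y ∈ Submodule.span Zq (Set.range fun α : ZIndex i → ℕ => zmono α) := by
    intro b y hy
    induction hy using Submodule.span_induction with
    | mem y hy =>
      obtain ⟨α, rfl⟩ := hy
      obtain ⟨c, hc⟩ := zgen_mul_list b α _ (Finset.sortedLT_sort Finset.univ).pairwise
        ((Finset.mem_sort _).2 (Finset.mem_univ b))
      dsimp only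
      rw [zmono, hc]
      exact Submodule.smul_mem _ _ (Submodule.subset_span ⟨_, rfl⟩)
    | zero => rw [mul_zero]; exact Submodule.zero_mem _
    | add y z _ _ hy hz => rw [mul_add]; exact Submodule.add_mem _ hy hz
    | smul c y _ hy => rw [mul_smul_comm]; exact Submodule.smul_mem _ _ hy
  have hall : ∀ (x : FreeAlgebra Zq (ZIndex i)) (y : ZG i),
      y ∈ Submodule.span Zq (Set.range fun α : ZIndex i → ℕ => zmono α) →
      RingQuot.mkAlgHom Zq (ZRel i) x * y ∈
        Submodule.span Zq (Set.range fun α : ZIndex i → ℕ => zmono α) := by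
    intro x
    induction x using FreeAlgebra.induction with
    | grade0 r =>
      intro y hy
      rw [AlgHom.commutes, ← Algebra.smul_def]
      exact Submodule.smul_mem _ _ hy
    | grade1 b => exact hgen b
    | mul a b ha hb => intro y hy; rw [map_mul, mul_assoc]; exact ha _ (hb _ hy)
    | add a b ha hb =>
      intro y hy; rw [map_add, add_mul]; exact Submodule.add_mem _ (ha _ hy) (hb _ hy)
  rintro y -
  obtain ⟨x, rfl⟩ := RingQuot.mkAlgHom_surjective Zq (ZRel i) y
  rw [← mul_one (RingQuot.mkAlgHom Zq (ZRel i) x)]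
  exact hall x 1 (Submodule.subset_span ⟨0, by simp [zmono]⟩)

/-- Left multiplication by a weight, in terms of the exponents of lexicographic monomials. -/
noncomputable def zop {n m : ℕ} {i : Fin m → Fin (n - 1)} (b : ZIndex i) :
    Module.End Zq ((ZIndex i → ℕ) →₀ Zq) :=
  Finsupp.linearCombination Zq fun α : ZIndex i → ℕ =>
    Finsupp.single (α + Pi.single b 1) (qh (∑ a, zexp a b * (α a : ℤ)))

theorem zop_single {n m : ℕ} {i : Fin m → Fin (n - 1)} (b : ZIndex i) (α : ZIndex i → ℕ)
    (c : Zq) : zop b (Finsupp.single α c) =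
      Finsupp.single (α + Pi.single b 1) (c * qh (∑ a, zexp a b * (α a : ℤ))) := by
  simp [zop]

theorem zop_zop {n m : ℕ} {i : Fin m → Fin (n - 1)} (b c : ZIndex i) (α : ZIndex i → ℕ) :
    zop b (zop c (Finsupp.single α 1)) = Finsupp.single (α + Pi.single c 1 + Pi.single b 1)
      (qh (∑ a, zexp a c * (α a : ℤ) + ∑ a, zexp a b * (α a : ℤ) + zexp c b)) := by
  rw [zop_single, zop_single, one_mul, qh, qh, ← LaurentPolynomial.T_add, ← qh]
  have : ∑ a, zexp a b * (((α + Pi.single c 1 : ZIndex i → ℕ) a : ℕ) : ℤ) =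
      ∑ a, zexp a b * (α a : ℤ) + zexp c b := by
    simp only [Pi.add_apply, Nat.cast_add, mul_add, Finset.sum_add_distrib, add_right_inj]
    rw [Finset.sum_eq_single c]
    · simp
    · intro a _ ha; simp [Pi.single_eq_of_ne ha]
    · simp
  rw [this, ← add_assoc (∑ a, zexp a c * (α a : ℤ))]

/-- The representation of `Z_G` on the free module with basis the exponent vectors. -/
noncomputable def zrep {n m : ℕ} (i : Fin m → Fin (n - 1)) :
    ZG i →ₐ[Zq] Module.End Zq ((ZIndex i → ℕ) →₀ Zq) :=
  RingQuot.liftAlgHom Zq ⟨FreeAlgebra.lift Zq zop, by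
    intro x y h
    cases h with
    | comm a b h =>
      simp only [map_mul, FreeAlgebra.lift_ι_apply]
      refine Finsupp.lhom_ext' fun α => LinearMap.ext_ring ?_
      have e1 : zexp a b = 0 := if_neg fun hh => by rcases h with h | h <;> simp_all
      have e2 : zexp b a = 0 := if_neg fun hh => by rcases h with h | h <;> simp_all
      simp only [LinearMap.comp_apply, Finsupp.lsingle_apply, Module.End.mul_apply, zop_zop,
        e1, e2]
      rw [add_right_comm α, add_comm (∑ c, zexp c a * (α c : ℤ))]
    | quasi a b hp hs ha hb =>
      simp only [map_mul, map_smul, FreeAlgebra.lift_ι_apply]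
      refine Finsupp.lhom_ext' fun α => LinearMap.ext_ring ?_
      have hlt : a.lev < b.lev := by rw [ha, hb, hp]; exact lo_lt_hi _
      have e1 : zexp a b = 1 := if_pos ⟨hp, hs, hlt⟩
      have e2 : zexp b a = 0 := if_neg fun hh => hlt.not_gt hh.2.2
      simp only [LinearMap.comp_apply, Finsupp.lsingle_apply, Module.End.mul_apply,
        LinearMap.smul_apply, zop_zop, e1, e2, Finsupp.smul_single, smul_eq_mul]
      rw [add_right_comm α, qh, qh, qh, ← LaurentPolynomial.T_add]
      congr 2
      ring⟩

theorem zrep_zgen {n m : ℕ} {i : Fin m → Fin (n - 1)} (a : ZIndex i) :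
    zrep i (zgen a) = zop a := by
  rw [zgen, zrep, RingQuot.liftAlgHom_mkAlgHom_apply, FreeAlgebra.lift_ι_apply]

theorem zrep_list {n m : ℕ} {i : Fin m → Fin (n - 1)} (α : ZIndex i → ℕ)
    (L : List (ZIndex i)) (hL : L.Pairwise (· < ·)) :
    zrep i (L.map fun a => zgen a ^ α a).prod (Finsupp.single 0 1) =
      Finsupp.single (fun c => if c ∈ L then α c else 0) 1 := by
  induction L with
  | nil => simp; rfl
  | cons a L ih =>
    rw [List.pairwise_cons] at hL
    rw [List.map_cons, List.prod_cons, map_mul, Module.End.mul_apply, ih hL.2, map_pow,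
      zrep_zgen]
    have hpow : ∀ k : ℕ, (zop a ^ k)
        (Finsupp.single (fun c => if c ∈ L then α c else 0) (1 : Zq)) =
        Finsupp.single ((fun c => if c ∈ L then α c else 0) + Pi.single a k) 1 := by
      intro k
      induction k with
      | zero => simp
      | succ k ihk =>
        rw [pow_succ', Module.End.mul_apply, ihk, zop_single, add_assoc, ← Pi.single_add]
        congr 1
        rw [Finset.sum_eq_zero, qh, LaurentPolynomial.T_zero, one_mul]
        intro c _
        by_cases hc : c.lev < a.lev
        · have hca : c < a := ZIndex.lt_of_lev_lt hc
          have h1 : c ∉ L := fun hcL => (hL.1 c hcL).not_gt hca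
          simp [h1, Pi.single_eq_of_ne hca.ne]
        · have : zexp c a = 0 := if_neg fun hh => hc hh.2.2
          rw [this, zero_mul]
    rw [hpow]
    congr 1
    funext c
    by_cases hc : c = a
    · subst hc
      have : c ∉ L := fun h => (hL.1 c h).ne rfl
      simp [this]
    · simp [hc]

theorem zrep_zmono {n m : ℕ} {i : Fin m → Fin (n - 1)} (α : ZIndex i → ℕ) :
    zrep i (zmono α) (Finsupp.single 0 1) = Finsupp.single α 1 := by
  rw [zmono, zrep_list α _ (Finset.sortedLT_sort Finset.univ).pairwise]
  simp

theorem linearIndependent_zmono {n m : ℕ} (i : Fin m → Fin (n - 1)) :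
    LinearIndependent Zq fun α : ZIndex i → ℕ => zmono (i := i) α := by
  have h := (Finsupp.basisSingleOne (R := Zq) (ι := ZIndex i → ℕ)).linearIndependent
  refine LinearIndependent.of_comp
    ((LinearMap.applyₗ (Finsupp.single (0 : ZIndex i → ℕ) (1 : Zq))) ∘ₗ
      (zrep i).toLinearMap) ?_
  convert h using 1
  funext α
  simp [zrep_zmono]

/-- The lexicographic basis of `Z_G`: the monomials in lexicographically ordered weights. -/
noncomputable def zBasis {n m : ℕ} (i : Fin m → Fin (n - 1)) :
    Module.Basis (ZIndex i → ℕ) Zq (ZG i) :=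
  Module.Basis.mk (linearIndependent_zmono i) (zmono_span i)

theorem zBasis_apply {n m : ℕ} (i : Fin m → Fin (n - 1)) (α : ZIndex i → ℕ) :
    zBasis i α = zmono α := Module.Basis.mk_apply _ _ _

/-- The coefficient `[z_G] f` in the lexicographic basis, where `z_G` is the product of all
weights in lexicographic order, that is, the basis monomial with all exponents `1`. -/
noncomputable def zcoeff {n m : ℕ} (i : Fin m → Fin (n - 1)) (f : ZG i) : Zq :=
  (zBasis i).repr f fun _ => 1

/-- The edges of the elementary diagram of the `k`-th generator lead from level `h` at its left to
level `h'` at its right: either through the central vertex or along a horizontal edge. -/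
def IsStep {n : ℕ} (k : Fin (n - 1)) (h h' : Fin n) : Prop :=
  (OnCross k h ∧ OnCross k h') ∨ (¬ OnCross k h ∧ h' = h)

/-- A path from source `a` to sink `b`, given by the levels at which it passes from each
elementary diagram to the next. These levels determine the edges of the path. -/
def IsPath {n m : ℕ} (i : Fin m → Fin (n - 1)) (a b : Fin n) (p : Fin (m + 1) → Fin n) : Prop :=
  p 0 = a ∧ p (Fin.last m) = b ∧ ∀ j : Fin m, IsStep (i j) (p j.castSucc) (p j.succ)

/-- The product of the weights of the edges by which a path traverses the `j`-th elementary
diagram from level `h` to level `h'`. Horizontal edges have weight `1`. -/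
noncomputable def stepWeight {n m : ℕ} (i : Fin m → Fin (n - 1)) (j : Fin m) (h h' : Fin n) :
    ZG i :=
  if H : OnCross (i j) h ∧ OnCross (i j) h' then
    zgen ⟨toLex (h, toLex (j, 0)), H.1⟩ * zgen ⟨toLex (h', toLex (j, 1)), H.2⟩
  else 1

/-- The weight of a path: the product of the weights of its edges, in the order of the path. -/
noncomputable def pathWeight {n m : ℕ} (i : Fin m → Fin (n - 1)) (p : Fin (m + 1) → Fin n) :
    ZG i :=
  (List.ofFn fun j : Fin m => stepWeight i j (p j.castSucc) (p j.succ)).prod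

open Classical in
/-- The weighted path matrix `B = (b_{a,b})` of the wiring diagram. -/
noncomputable def pathMatrix {n m : ℕ} (i : Fin m → Fin (n - 1)) :
    Matrix (Fin n) (Fin n) (ZG i) :=
  Matrix.of fun a b => ∑ p : Fin (m + 1) → Fin n with IsPath i a b p, pathWeight i p

/-- The product `b_{1,v_1} ⋯ b_{n,v_n}` of entries of the weighted path matrix. -/
noncomputable def bmon {n m : ℕ} (i : Fin m → Fin (n - 1)) (v : Equiv.Perm (Fin n)) : ZG i :=
  (List.ofFn fun a => pathMatrix i a (v a)).prod

/-! ### The evaluation map and immanants -/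

/-- The evaluation map `σ_B`: the linear map on the zero-weight space sending the natural basis
element `x^{e,v}` to the coefficient `[z_G] b_{1,v_1} ⋯ b_{n,v_n}`. -/
noncomputable def sigma {n m : ℕ} (i : Fin m → Fin (n - 1)) : zeroWeight n →ₗ[Zq] Zq :=
  (zwBasis n).constr Zq fun v => zcoeff i (bmon i v)

theorem sigma_xmon {n m : ℕ} (i : Fin m → Fin (n - 1)) (v : Equiv.Perm (Fin n)) :
    sigma i ⟨xmon 1 v, xmon_mem 1 v⟩ = zcoeff i (bmon i v) := by
  have : (⟨xmon 1 v, xmon_mem 1 v⟩ : zeroWeight n) = zwBasis n v :=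
    Subtype.ext (zwBasis_apply v).symm
  rw [this, sigma, Module.Basis.constr_basis]

/-- The `θ`-immanant `∑_w θ(T_w) q^{-ℓ(w)/2} x_{1,w_1} ⋯ x_{n,w_n}` in the zero-weight space. -/
noncomputable def immanant {n : ℕ} (θ : Hecke n →ₗ[Zq] Zq) : zeroWeight n :=
  ∑ w : Equiv.Perm (Fin n),
    (θ (heckeT w) * qh (-(len w : ℤ))) • (⟨xmon 1 w, xmon_mem 1 w⟩ : zeroWeight n)

end QImm

namespace QImm

/-! Both sides are one weighted count of the families of `n` paths that together use every edge of
the wiring diagram exactly once. At the central vertex of each elementary diagram two such paths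
either cross or bounce. Recording the levels of all paths between consecutive diagrams therefore
gives permutations u_0 = e, u_1, …, u_m in which u_j is u_{j-1} or s_{i_j} u_{j-1} (`isStep_iff`).
Such a family counts with a factor q^{1/2} for each side, left or right, of each central vertex at
which the path on the lower level has the larger source. This exponent is `coverExp`.

On the Hecke side, put T'_w = q^{-ℓ(w)/2} T_w. Right multiplication of T'_w by 1 + T_s yields T'_w
and T'_{sw}, and the coefficient of each target T'_{w'} is q^{1/2} to the number of inversions of
the pair at s in w and in w' (`heckeT_mul_one_add_normalized`). Iterating from T'_e = 1 sums over
all sequences u, with the weight above, the elements T'_{u_m} (`heckeT_mul_prod`).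

On the matrix side, b_{1,v_1} ⋯ b_{n,v_n} expands over families of paths, and each term is a power
of q^{1/2} times one lexicographic monomial. That monomial is z_G exactly when the family comes from
a sequence of permutations (`sum_pathExp_pathFamily`, `exists_pathFamily_eq`). Path weights are
multiplied in the order of the sources, so sorting produces q^{1/2} precisely when an earlier path
uses the upper edge and a later one the lower edge on the same side of a central vertex
(`sum_zform_pathFamily`). Hence [z_G] b_{1,v_1} ⋯ b_{n,v_n} is the weighted count of the sequences
ending at v (`zcoeff_bmon`).

So this number is also the coefficient of T'_v in the product (`prod_one_add_heckeGen`), and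
applying the linear map `θ` gives the evaluation of the immanant. -/

/-! ### Right multiplication by 1 + T_s in the Hecke algebra. -/

theorem inv_symm {n : ℕ} (w : Equiv.Perm (Fin n)) : inv w⁻¹ = inv w := by
  unfold inv
  refine Finset.card_bij' (fun p _ => (w⁻¹ p.2, w⁻¹ p.1)) (fun p _ => (w p.2, w p.1)) ?_ ?_ ?_ ?_
    <;> simp +contextual

theorem inv_adj_mul {n : ℕ} {w : Equiv.Perm (Fin n)} {k : Fin (n - 1)}
    (h : w⁻¹ (lo k) < w⁻¹ (hi k)) : inv (adj k * w) = inv w + 1 := by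
  rw [← inv_symm w, ← inv_mul_adj h, ← inv_symm, mul_inv_rev, adj, Equiv.swap_inv]

theorem adj_adj_mul {n : ℕ} (k : Fin (n - 1)) (w : Equiv.Perm (Fin n)) :
    adj k * (adj k * w) = w := by
  rw [← mul_assoc, adj_mul_self, one_mul]

theorem wordPerm_append_singleton {n : ℕ} (l : List (Fin (n - 1))) (k : Fin (n - 1)) :
    wordPerm (l ++ [k]) = adj k * wordPerm l := by
  induction l with
  | nil => simp [wordPerm]
  | cons a l ih => rw [List.cons_append, wordPerm, ih, wordPerm, mul_assoc]

theorem heckeT_one {n : ℕ} : heckeT (1 : Equiv.Perm (Fin n)) = 1 := by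
  have h : IsReduced ([] : List (Fin (n - 1))) := fun _ _ => Nat.zero_le _
  simpa [wordPerm] using heckeT_wordPerm h

/-- Right multiplication appends a letter to a reduced word. As `wordPerm` composes in reverse, this
multiplies the permutation by `adj k` on the left, exchanging the values `lo k` and `hi k`; the
hypothesis, that `lo k` precedes `hi k` in one-line notation, keeps the longer word reduced. -/
theorem heckeT_mul_heckeGen {n : ℕ} {w : Equiv.Perm (Fin n)} {k : Fin (n - 1)}
    (h : w⁻¹ (lo k) < w⁻¹ (hi k)) : heckeT w * heckeGen k = heckeT (adj k * w) := by
  have hred : IsReduced (redWord w ++ [k]) := by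
    rw [isReduced_iff, wordPerm_append_singleton, wordPerm_redWord, inv_adj_mul h,
      List.length_append, List.length_singleton, ← len, len_eq_inv]
  have := heckeT_wordPerm hred
  rw [wordPerm_append_singleton, wordPerm_redWord] at this
  rw [this, List.map_append, List.prod_append, ← heckeT, List.map_singleton, List.prod_singleton]

theorem heckeGen_mul_self {n : ℕ} (k : Fin (n - 1)) :
    (heckeGen k * heckeGen k : Hecke n) = (qh 2 - 1) • heckeGen k + qh 2 • 1 := by
  have := RingQuot.mkAlgHom_rel Zq (HeckeRel.quad (n := n) k)
  simpa only [map_mul, map_add, map_smul, map_one, ← heckeGen.eq_def] using this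

/-- The indicator of `k` being a descent of the inverse of `w`. -/
def descent {n : ℕ} (w : Equiv.Perm (Fin n)) (k : Fin (n - 1)) : ℤ :=
  if w⁻¹ (hi k) < w⁻¹ (lo k) then 1 else 0

theorem qh_add (a b : ℤ) : qh (a + b) = qh a * qh b := LaurentPolynomial.T_add a b

theorem qh_zero : qh 0 = 1 := LaurentPolynomial.T_zero

theorem descent_adj_mul {n : ℕ} (w : Equiv.Perm (Fin n)) (k : Fin (n - 1)) :
    descent (adj k * w) k = 1 - descent w k := by
  have e : (adj k)⁻¹ = adj k := Equiv.swap_inv _ _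
  unfold descent
  simp only [mul_inv_rev, Equiv.Perm.mul_apply, e, adj_lo, adj_hi]
  rcases lt_or_gt_adj w⁻¹ k with h | h
  · rw [if_pos h, if_neg h.not_gt, sub_zero]
  · rw [if_pos h, if_neg h.not_gt, sub_self]

theorem len_adj_mul {n : ℕ} (w : Equiv.Perm (Fin n)) (k : Fin (n - 1)) :
    (len (adj k * w) : ℤ) = len w + 1 - 2 * descent w k := by
  rw [len_eq_inv, len_eq_inv]
  rcases lt_or_gt_adj w⁻¹ k with h | h
  · rw [inv_adj_mul h, descent, if_neg h.not_gt]; push_cast; ring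
  · have e : (adj k)⁻¹ = adj k := Equiv.swap_inv _ _
    -- The length-increasing case applies to `adj k * w`, and a second multiplication by `adj k`
    -- returns to `w`.
    have h' : (adj k * w)⁻¹ (lo k) < (adj k * w)⁻¹ (hi k) := by
      simpa only [mul_inv_rev, Equiv.Perm.mul_apply, e, adj_lo, adj_hi] using h
    have := inv_adj_mul h'
    rw [adj_adj_mul] at this
    rw [this, descent, if_pos h]; push_cast; ring

/-- Without a descent this is the length-increasing product rule. With a descent, T_w = T_{sw} T_s,
and the quadratic relation gives T_w T_s = (q-1) T_w + q T_{sw}; adding T_w makes both coefficients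
equal to q. -/
theorem heckeT_mul_one_add {n : ℕ} (w : Equiv.Perm (Fin n)) (k : Fin (n - 1)) :
    heckeT w * (1 + heckeGen k) = qh (2 * descent w k) • (heckeT w + heckeT (adj k * w)) := by
  rcases lt_or_gt_adj w⁻¹ k with h | h
  · rw [descent, if_neg h.not_gt, mul_zero, qh_zero, one_smul, mul_add, mul_one,
      heckeT_mul_heckeGen h]
  · have e : (adj k)⁻¹ = adj k := Equiv.swap_inv _ _
    have h' : (adj k * w)⁻¹ (lo k) < (adj k * w)⁻¹ (hi k) := by
      simpa only [mul_inv_rev, Equiv.Perm.mul_apply, e, adj_lo, adj_hi] using h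
    have h2 := heckeT_mul_heckeGen h'
    rw [adj_adj_mul] at h2
    rw [descent, if_pos h, mul_one, mul_add, mul_one]
    nth_rewrite 2 [← h2]
    rw [mul_assoc, heckeGen_mul_self, mul_add, mul_smul_comm, mul_smul_comm, h2, mul_one,
      smul_add, ← add_assoc]
    nth_rewrite 1 [← one_smul Zq (heckeT w)]
    rw [← add_smul, add_sub_cancel]

/-- Normalizing by q^{-ℓ/2} makes the exponent symmetric in source and target: one contribution from
each, just as a crossing carries weights on its left and on its right. This is the form that matches
the path count. -/
theorem heckeT_mul_one_add_normalized {n : ℕ} (w : Equiv.Perm (Fin n)) (k : Fin (n - 1)) :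
    qh (-(len w : ℤ)) • heckeT w * (1 + heckeGen k) =
      qh (descent w k + descent w k) • qh (-(len w : ℤ)) • heckeT w +
      qh (descent w k + descent (adj k * w) k) •
        qh (-(len (adj k * w) : ℤ)) • heckeT (adj k * w) := by
  rw [smul_mul_assoc, heckeT_mul_one_add, smul_add, smul_add, smul_smul, smul_smul, smul_smul,
    smul_smul]
  simp only [← qh_add, len_adj_mul, descent_adj_mul]
  congr 3 <;> ring

/-! ### Coverings of the diagram and the expansion of the product. -/

/-- Levels off the crossing are fixed, and the two paths on it keep to those two levels; injectivity
of `w'` leaves only the choice between bouncing and crossing. -/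
theorem isStep_iff {n : ℕ} (k : Fin (n - 1)) (w w' : Equiv.Perm (Fin n)) :
    (∀ a, IsStep k (w a) (w' a)) ↔ w' = w ∨ w' = adj k * w := by
  have hw' : ∀ b, w (w⁻¹ b) = b := w.apply_symm_apply
  constructor
  · intro h
    have hlo : w' (w⁻¹ (lo k)) = lo k ∨ w' (w⁻¹ (lo k)) = hi k := by
      have := h (w⁻¹ (lo k))
      simp only [IsStep, OnCross, hw'] at this
      tauto
    have hhi : w' (w⁻¹ (hi k)) = lo k ∨ w' (w⁻¹ (hi k)) = hi k := by
      have := h (w⁻¹ (hi k))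
      simp only [IsStep, OnCross, hw'] at this
      tauto
    have hne : w' (w⁻¹ (lo k)) ≠ w' (w⁻¹ (hi k)) := fun hh =>
      (lo_lt_hi k).ne (w⁻¹.injective (w'.injective hh))
    have hother : ∀ a, w a ≠ lo k → w a ≠ hi k → w' a = w a := by
      intro a h1 h2
      have := h a
      simp only [IsStep, OnCross] at this
      tauto
    have hcase : ∀ a, a = w⁻¹ (lo k) ∨ a = w⁻¹ (hi k) ∨ (w a ≠ lo k ∧ w a ≠ hi k) := by
      intro a
      simp only [Equiv.Perm.eq_inv_iff_eq]
      tauto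
    rcases hlo with hlo | hlo
    · have hhi' : w' (w⁻¹ (hi k)) = hi k := by
        rcases hhi with hh | hh
        · exact absurd (hlo.trans hh.symm) hne
        · exact hh
      left
      ext1 a
      rcases hcase a with rfl | rfl | ⟨h1, h2⟩
      · rw [hlo, hw']
      · rw [hhi', hw']
      · exact hother a h1 h2
    · have hhi' : w' (w⁻¹ (hi k)) = lo k := by
        rcases hhi with hh | hh
        · exact hh
        · exact absurd (hlo.trans hh.symm) hne
      right
      ext1 a
      rw [Equiv.Perm.mul_apply]
      rcases hcase a with rfl | rfl | ⟨h1, h2⟩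
      · rw [hlo, hw', adj_lo]
      · rw [hhi', hw', adj_hi]
      · rw [hother a h1 h2, adj_of_ne h1 h2]
  · rintro (rfl | rfl) a
    · by_cases h : OnCross k (w' a)
      · exact Or.inl ⟨h, h⟩
      · exact Or.inr ⟨h, rfl⟩
    · rw [Equiv.Perm.mul_apply]
      by_cases h : OnCross k (w a)
      · refine Or.inl ⟨h, ?_⟩
        rcases h with h | h <;> rw [h]
        · rw [adj_lo]; exact Or.inr rfl
        · rw [adj_hi]; exact Or.inl rfl
      · refine Or.inr ⟨h, ?_⟩
        rw [OnCross, not_or] at h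
        exact adj_of_ne h.1 h.2

/-- A sequence of permutations, starting at `w`, whose entries are the levels of a family of
paths covering the wiring diagram. -/
def IsCovering {n m : ℕ} (i : Fin m → Fin (n - 1)) (w : Equiv.Perm (Fin n))
    (u : Fin (m + 1) → Equiv.Perm (Fin n)) : Prop :=
  u 0 = w ∧ ∀ j : Fin m, ∀ a, IsStep (i j) (u j.castSucc a) (u j.succ a)

/-- The number of inverted pairs of paths at the left and right sides of the crossings. -/
def coverExp {n m : ℕ} (i : Fin m → Fin (n - 1)) (u : Fin (m + 1) → Equiv.Perm (Fin n)) : ℤ :=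
  ∑ j : Fin m, (descent (u j.castSucc) (i j) + descent (u j.succ) (i j))

theorem isCovering_cons {n m : ℕ} (i : Fin (m + 1) → Fin (n - 1)) (w w' : Equiv.Perm (Fin n))
    (u : Fin (m + 1) → Equiv.Perm (Fin n)) :
    IsCovering i w (Fin.cons w' u : Fin (m + 2) → _) ↔
      w' = w ∧ (u 0 = w ∨ u 0 = adj (i 0) * w) ∧ IsCovering (fun j => i j.succ) (u 0) u := by
  unfold IsCovering
  rw [Fin.cons_zero, Fin.forall_fin_succ]
  constructor
  · rintro ⟨rfl, h1, h2⟩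
    refine ⟨rfl, (isStep_iff _ _ _).1 (by simpa using h1), rfl, fun j => ?_⟩
    simpa [← Fin.succ_castSucc] using h2 j
  · rintro ⟨rfl, h1, -, h2⟩
    refine ⟨rfl, by simpa using (isStep_iff _ _ _).2 h1, fun j => ?_⟩
    simpa [← Fin.succ_castSucc] using h2 j

theorem coverExp_cons {n m : ℕ} (i : Fin (m + 1) → Fin (n - 1)) (w : Equiv.Perm (Fin n))
    (u : Fin (m + 1) → Equiv.Perm (Fin n)) :
    coverExp i (Fin.cons w u : Fin (m + 2) → _) =
      descent w (i 0) + descent (u 0) (i 0) + coverExp (fun j => i j.succ) u := by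
  unfold coverExp
  rw [Fin.sum_univ_succ]
  simp

-- Induction on `m`, with an arbitrary starting permutation because the first factor moves `w` to
-- either of two permutations, from each of which the remaining factors are expanded.
open Classical in
theorem heckeT_mul_prod {n m : ℕ} (i : Fin m → Fin (n - 1)) (w : Equiv.Perm (Fin n)) :
    qh (-(len w : ℤ)) • heckeT w * (List.ofFn fun j => 1 + heckeGen (i j)).prod =
      ∑ u : Fin (m + 1) → Equiv.Perm (Fin n) with IsCovering i w u,
        qh (coverExp i u) •
          qh (-(len (u (Fin.last m)) : ℤ)) • heckeT (u (Fin.last m)) := by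
  induction m generalizing w with
  | zero =>
    rw [Finset.sum_eq_single (fun _ => w)]
    · simp [coverExp, qh_zero]
    · intro u hu hne
      refine absurd (funext fun j => ?_) hne
      rw [← (Finset.mem_filter.1 hu).2.1, Fin.fin_one_eq_zero j]
    · intro h
      exact absurd (Finset.mem_filter.2 ⟨Finset.mem_univ _, rfl, fun j => j.elim0⟩) h
  | succ m ih =>
    -- Equality would force the integer `descent w (i 0)` to satisfy d = 1 - d.
    have hne : w ≠ adj (i 0) * w := by
      intro h
      have h1 := descent_adj_mul w (i 0)
      rw [← h] at h1
      omega
    have hce : ∀ (w' : Equiv.Perm (Fin n)) (u : Fin (m + 1) → Equiv.Perm (Fin n)),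
        Fin.consEquiv (fun _ => Equiv.Perm (Fin n)) (w', u) = Fin.cons w' u := fun _ _ => rfl
    have hsub : ∀ w' : Equiv.Perm (Fin n), (w' = w ∨ w' = adj (i 0) * w) →
        ∑ u : Fin (m + 1) → Equiv.Perm (Fin n) with
            IsCovering (fun j => i j.succ) w' u,
          qh (coverExp i (Fin.cons w u : Fin (m + 2) → _)) •
            qh (-(len (u (Fin.last m)) : ℤ)) • heckeT (u (Fin.last m)) =
        qh (descent w (i 0) + descent w' (i 0)) • qh (-(len w' : ℤ)) • heckeT w' *
          (List.ofFn fun j : Fin m => 1 + heckeGen (i j.succ)).prod := by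
      intro w' _
      rw [smul_mul_assoc, ih, Finset.smul_sum]
      refine Finset.sum_congr rfl fun u hu => ?_
      have hu0 := (Finset.mem_filter.1 hu).2.1
      rw [coverExp_cons, hu0, qh_add, mul_smul]
    rw [List.ofFn_succ, List.prod_cons, ← mul_assoc, heckeT_mul_one_add_normalized, add_mul,
      ← hsub w (Or.inl rfl), ← hsub _ (Or.inr rfl)]
    simp only [Finset.sum_filter]
    -- A sequence is split into its first entry and its tail; only the first entry `w` contributes.
    conv_rhs => rw [← (Fin.consEquiv fun _ => Equiv.Perm (Fin n)).sum_comp]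
    rw [← Finset.sum_add_distrib,
      Fintype.sum_prod_type, Finset.sum_eq_single w]
    · refine Finset.sum_congr rfl fun u _ => ?_
      simp only [hce, isCovering_cons, true_and]
      have hl : (Fin.cons w u : Fin (m + 2) → Equiv.Perm (Fin n)) (Fin.last (m + 1)) =
          u (Fin.last m) := by rw [← Fin.succ_last, Fin.cons_succ]
      rw [hl]
      -- The entry `u 0` decides which of the two sums contains `u`; by `hne` it is never in both.
      by_cases hc : IsCovering (fun j => i j.succ) (u 0) u
      · by_cases h1 : u 0 = w
        · rw [h1] at hc
          have : ¬ IsCovering (fun j => i j.succ) (adj (i 0) * w) u := fun h =>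
            hne (h1.symm.trans h.1)
          simp [hc, h1, this]
        · have h1' : ¬ IsCovering (fun j => i j.succ) w u := fun h => h1 h.1
          by_cases h2 : u 0 = adj (i 0) * w
          · rw [h2] at hc
            simp [hc, h2, h1']
          · have : ¬ IsCovering (fun j => i j.succ) (adj (i 0) * w) u := fun h => h2 h.1
            simp [h1, h2, h1', this]
      · have h0 : ∀ w', ¬ IsCovering (fun j => i j.succ) w' u := fun w' h =>
          hc ⟨rfl, h.2⟩
        simp [h0]
    · intro w' _ hw'
      refine Finset.sum_eq_zero fun u _ => if_neg ?_
      rw [hce]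
      exact fun h => hw' ((isCovering_cons _ _ _ _).1 h).1
    · simp

/-! ### Powers of q^{1/2} from reordering monomials in the edge weights. -/

/-- The index of the weight at the lower level and at side `k` of the `j`-th crossing. -/
def loIdx {n m : ℕ} (i : Fin m → Fin (n - 1)) (j : Fin m) (k : Fin 2) : ZIndex i :=
  ⟨toLex (lo (i j), toLex (j, k)), Or.inl rfl⟩

/-- The index of the weight at the upper level and at side `k` of the `j`-th crossing. -/
def hiIdx {n m : ℕ} (i : Fin m → Fin (n - 1)) (j : Fin m) (k : Fin 2) : ZIndex i :=
  ⟨toLex (hi (i j), toLex (j, k)), Or.inr rfl⟩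

theorem ZIndex.ext' {n m : ℕ} {i : Fin m → Fin (n - 1)} {a b : ZIndex i}
    (hl : a.lev = b.lev) (hp : a.pos = b.pos) (hs : a.side = b.side) : a = b :=
  Subtype.ext (Prod.ext hl (Prod.ext hp hs))

/-- The bilinear form giving the power of `q^{1/2}` that arises from multiplying two monomials
with given exponents. -/
noncomputable def zform {n m : ℕ} {i : Fin m → Fin (n - 1)} (α β : ZIndex i → ℕ) : ℤ :=
  ∑ j, ∑ k, (α (loIdx i j k) : ℤ) * β (hiIdx i j k)

theorem zform_add_left {n m : ℕ} {i : Fin m → Fin (n - 1)} (α β γ : ZIndex i → ℕ) :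
    zform (α + β) γ = zform α γ + zform β γ := by
  simp [zform, add_mul, Finset.sum_add_distrib]

theorem zform_add_right {n m : ℕ} {i : Fin m → Fin (n - 1)} (α β γ : ZIndex i → ℕ) :
    zform α (β + γ) = zform α β + zform α γ := by
  simp [zform, mul_add, Finset.sum_add_distrib]

theorem zform_zero_left {n m : ℕ} {i : Fin m → Fin (n - 1)} (α : ZIndex i → ℕ) :
    zform 0 α = 0 := by simp [zform]

theorem zform_zero_right {n m : ℕ} {i : Fin m → Fin (n - 1)} (α : ZIndex i → ℕ) :
    zform α 0 = 0 := by simp [zform]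

theorem zform_sum_left {n m : ℕ} {i : Fin m → Fin (n - 1)} {ι : Type*} (s : Finset ι)
    (f : ι → ZIndex i → ℕ) (α : ZIndex i → ℕ) :
    zform (∑ x ∈ s, f x) α = ∑ x ∈ s, zform (f x) α := by
  classical
  induction s using Finset.induction_on with
  | empty => simp [zform_zero_left]
  | insert a s ha ih => rw [Finset.sum_insert ha, Finset.sum_insert ha, zform_add_left, ih]

/-- Rewrites the exponent in `zop` as a value of the bilinear form: only an upper weight picks up a
power, and only from the lower weight with the same crossing and side. -/
theorem sum_zexp_mul {n m : ℕ} {i : Fin m → Fin (n - 1)} (α : ZIndex i → ℕ) (b : ZIndex i) :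
    ∑ a, zexp a b * (α a : ℤ) = zform α (Pi.single b 1) := by
  -- The second argument is supported at `b`, so at most one term of the form survives, and only if
  -- `b` is an upper weight.
  have hR : zform α (Pi.single b 1) =
      if b.lev = hi (i b.pos) then (α (loIdx i b.pos b.side) : ℤ) else 0 := by
    have key : ∀ j k, hiIdx i j k = b ↔
        b.lev = hi (i b.pos) ∧ j = b.pos ∧ k = b.side := by
      intro j k
      constructor
      · rintro rfl; exact ⟨rfl, rfl, rfl⟩
      · rintro ⟨h, rfl, rfl⟩; exact ZIndex.ext' h.symm rfl rfl
    unfold zform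
    simp only [Pi.single_apply, key]
    by_cases h : b.lev = hi (i b.pos)
    · rw [Finset.sum_eq_single b.pos, Finset.sum_eq_single b.side] <;> simp +contextual [h]
    · simp [h]
  rw [hR]
  split_ifs with h
  · rw [Finset.sum_eq_single (loIdx i b.pos b.side)]
    · have : zexp (loIdx i b.pos b.side) b = 1 :=
        if_pos ⟨rfl, rfl, by rw [h]; exact lo_lt_hi _⟩
      rw [this, one_mul]
    · intro a _ ha
      have : zexp a b = 0 := if_neg fun hh => ha (ZIndex.ext' (by
        rcases a.lev_cases with h1 | h1
        · rw [h1, hh.1]; rfl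
        · rw [h1, h, hh.1] at hh
          exact absurd hh.2.2 (lt_irrefl _)) hh.1 hh.2.1)
      rw [this, zero_mul]
    · simp
  · refine Finset.sum_eq_zero fun a _ => ?_
    have : zexp a b = 0 := if_neg fun hh => by
      have hb := b.lev_cases.resolve_right h
      have h3 := hh.2.2
      rw [hb] at h3
      rcases a.lev_cases with h1 | h1
      · rw [h1, hh.1] at h3; exact lt_irrefl _ h3
      · rw [h1, hh.1] at h3; exact (lo_lt_hi _).not_gt h3
    rw [this, zero_mul]

/-- In the representation `zrep`, the element `x` acts as `q^{e/2}` times the lexicographic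
monomial with exponents `β`. -/
def IsShift {n m : ℕ} {i : Fin m → Fin (n - 1)} (x : ZG i) (β : ZIndex i → ℕ) (e : ℤ) : Prop :=
  ∀ (α : ZIndex i → ℕ) (c : Zq),
    zrep i x (Finsupp.single α c) = Finsupp.single (α + β) (c * qh (zform α β + e))

theorem IsShift.one {n m : ℕ} {i : Fin m → Fin (n - 1)} : IsShift (1 : ZG i) 0 0 := by
  intro α c
  simp [zform_zero_right, qh_zero]

theorem IsShift.zgen {n m : ℕ} {i : Fin m → Fin (n - 1)} (b : ZIndex i) :
    IsShift (zgen b) (Pi.single b 1) 0 := by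
  intro α c
  rw [zrep_zgen, zop_single, sum_zexp_mul, add_zero]

/-- In `x * y` the lower weights of `y` must pass the upper weights of `x` to reach lexicographic
order, which explains the extra term with the arguments in reversed order. -/
theorem IsShift.mul {n m : ℕ} {i : Fin m → Fin (n - 1)} {x y : ZG i} {β γ : ZIndex i → ℕ}
    {e f : ℤ} (hx : IsShift x β e) (hy : IsShift y γ f) :
    IsShift (x * y) (β + γ) (e + f + zform γ β) := by
  intro α c
  rw [map_mul, Module.End.mul_apply, hy, hx, mul_assoc, ← qh_add, zform_add_left, zform_add_right,
    add_assoc α, add_comm γ]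
  congr 3
  ring

/-- Each factor is already sorted up to a trivial power, so only pairs of distinct factors
contribute, through the form of the later against the earlier. -/
theorem IsShift.prod {n m : ℕ} {i : Fin m → Fin (n - 1)} {N : ℕ} {x : Fin N → ZG i}
    {β : Fin N → ZIndex i → ℕ} (h : ∀ a, IsShift (x a) (β a) 0) :
    IsShift (List.ofFn x).prod (∑ a, β a)
      (∑ a, ∑ b, if a < b then zform (β b) (β a) else 0) := by
  induction N with
  | zero => simpa using IsShift.one
  | succ N ih =>
    have := (h 0).mul (ih fun a => h a.succ)
    rw [List.ofFn_succ, List.prod_cons, Fin.sum_univ_succ]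
    convert this using 1
    rw [Fin.sum_univ_succ, zform_sum_left]
    simp only [Fin.sum_univ_succ, Fin.succ_lt_succ_iff, Fin.succ_pos, if_true, lt_irrefl, if_false,
      Fin.not_lt_zero, zero_add]
    exact add_comm _ _

/-- Acting on the vector of exponent zero sends each lexicographic monomial to the corresponding
basis vector, so coefficients can be read off in the representation instead of through `zBasis`. -/
theorem zcoeff_eq {n m : ℕ} (i : Fin m → Fin (n - 1)) (f : ZG i) :
    zcoeff i f = zrep i f (Finsupp.single 0 1) fun _ => 1 := by
  have : (Finsupp.lapply (fun _ => 1)) ∘ₗ (zBasis i).repr.toLinearMap =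
      (Finsupp.lapply (fun _ => 1)) ∘ₗ (LinearMap.applyₗ (Finsupp.single (0 : ZIndex i → ℕ)
        (1 : Zq))) ∘ₗ (zrep i).toLinearMap := by
    refine (zBasis i).ext fun α => ?_
    simp only [LinearMap.comp_apply, LinearEquiv.coe_coe, Module.Basis.repr_self,
      AlgHom.toLinearMap_apply, LinearMap.applyₗ_apply_apply]
    rw [zBasis_apply, zrep_zmono]
  exact LinearMap.congr_fun this f

theorem zcoeff_sum {n m : ℕ} (i : Fin m → Fin (n - 1)) {ι : Type*} (s : Finset ι)
    (f : ι → ZG i) : zcoeff i (∑ x ∈ s, f x) = ∑ x ∈ s, zcoeff i (f x) := by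
  simp [zcoeff_eq, Finsupp.finsetSum_apply]

open Classical in
theorem IsShift.zcoeff_eq {n m : ℕ} {i : Fin m → Fin (n - 1)} {x : ZG i} {β : ZIndex i → ℕ}
    {e : ℤ} (h : IsShift x β e) : zcoeff i x = if β = fun _ => 1 then qh e else 0 := by
  rw [QImm.zcoeff_eq, h, zform_zero_left, zero_add, zero_add, one_mul, Finsupp.single_apply]

/-! ### Exponents of the weight of a single path. -/

/-- The level at which a path crosses the edge column of the index `a`. -/
def levelAt {n m : ℕ} {i : Fin m → Fin (n - 1)} {X : Type*} (p : Fin (m + 1) → X)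
    (a : ZIndex i) : X := if a.side = 0 then p a.pos.castSucc else p a.pos.succ

/-- The exponents of the weight of a path. -/
def pathExp {n m : ℕ} (i : Fin m → Fin (n - 1)) (p : Fin (m + 1) → Fin n) (a : ZIndex i) : ℕ :=
  if levelAt p a = a.lev then 1 else 0

/-- The two weights of one passage lie on different sides of the central vertex, hence commute, and
no power of q^{1/2} appears. A horizontal step has weight 1 and meets no weighted edge of this
crossing. -/
theorem isShift_stepWeight {n m : ℕ} {i : Fin m → Fin (n - 1)} {j : Fin m}
    {p : Fin (m + 1) → Fin n} (h : IsStep (i j) (p j.castSucc) (p j.succ)) :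
    IsShift (stepWeight i j (p j.castSucc) (p j.succ))
      (fun a => if a.pos = j then pathExp i p a else 0) 0 := by
  by_cases H : OnCross (i j) (p j.castSucc) ∧ OnCross (i j) (p j.succ)
  · rw [stepWeight, dif_pos H]
    set x : ZIndex i := ⟨toLex (p j.castSucc, toLex (j, 0)), H.1⟩ with hx
    set y : ZIndex i := ⟨toLex (p j.succ, toLex (j, 1)), H.2⟩ with hy
    have e : zform (Pi.single y 1 : ZIndex i → ℕ) (Pi.single x 1) = 0 := by
      refine Finset.sum_eq_zero fun j' _ => Finset.sum_eq_zero fun k _ => ?_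
      by_cases h1 : loIdx i j' k = y
      · have h2 : hiIdx i j' k ≠ x := by
          intro h2
          have e1 : k = 1 := congrArg ZIndex.side h1
          have e2 : k = 0 := congrArg ZIndex.side h2
          simp [e1] at e2
        simp [Pi.single_eq_of_ne h2]
      · simp [Pi.single_eq_of_ne h1]
    have := (IsShift.zgen x).mul (IsShift.zgen y)
    rw [e, add_zero, add_zero] at this
    convert this using 1
    funext a
    have hax : a = x ↔ a.side = 0 ∧ a.pos = j ∧ p j.castSucc = a.lev := by
      constructor
      · rintro rfl; exact ⟨rfl, rfl, rfl⟩
      · rintro ⟨h1, h2, h3⟩; exact ZIndex.ext' h3.symm h2 h1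
    have hay : a = y ↔ a.side = 1 ∧ a.pos = j ∧ p j.succ = a.lev := by
      constructor
      · rintro rfl; exact ⟨rfl, rfl, rfl⟩
      · rintro ⟨h1, h2, h3⟩; exact ZIndex.ext' h3.symm h2 h1
    rw [Pi.add_apply, Pi.single_apply, Pi.single_apply]
    simp only [hax, hay, pathExp, levelAt]
    by_cases hj : a.pos = j
    · have h01 : a.side = 0 ∨ a.side = 1 := by omega
      rcases h01 with h0 | h0 <;> simp [h0, hj]
    · simp [hj]
  · rw [stepWeight, dif_neg H]
    have h' := h.resolve_left H
    convert IsShift.one using 1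
    funext a
    rw [Pi.zero_apply]
    split_ifs with hj
    · subst hj
      refine if_neg fun hl => ?_
      -- On a horizontal step the level is the same on both sides, so a nonzero exponent on either
      -- side would put the starting level on the crossing.
      have : levelAt p a = p a.pos.castSucc := by
        unfold levelAt; split_ifs <;> simp [h'.2]
      rw [this] at hl
      exact h'.1 (hl ▸ a.2)
    · rfl

theorem isShift_pathWeight {n m : ℕ} {i : Fin m → Fin (n - 1)} {p : Fin (m + 1) → Fin n}
    (h : ∀ j : Fin m, IsStep (i j) (p j.castSucc) (p j.succ)) :
    IsShift (pathWeight i p) (pathExp i p) 0 := by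
  convert IsShift.prod fun j => isShift_stepWeight (h j) using 1
  · rfl
  · funext a
    rw [Finset.sum_apply, Finset.sum_ite_eq, if_pos (Finset.mem_univ _)]
  · symm
    -- Weights of different crossings commute, so the cross terms between steps vanish.
    refine Finset.sum_eq_zero fun j _ => Finset.sum_eq_zero fun j' _ => ?_
    split_ifs with hjj
    · refine Finset.sum_eq_zero fun l _ => Finset.sum_eq_zero fun k _ => ?_
      have h1 : (loIdx i l k).pos = l := rfl
      have h2 : (hiIdx i l k).pos = l := rfl
      simp only [h1, h2]
      by_cases hl : l = j
      · have : l ≠ j' := hl ▸ hjj.ne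
        simp [this]
      · simp [hl]
    · rfl

/-! ### Families of paths and the coefficient of z_G. -/

theorem bmon_eq_sum {n m : ℕ} (i : Fin m → Fin (n - 1)) (v : Equiv.Perm (Fin n)) :
    bmon i v = open Classical in
      ∑ P : Fin n → Fin (m + 1) → Fin n with ∀ a, IsPath i a (v a) (P a),
        (List.ofFn fun a => pathWeight i (P a)).prod := by
  classical
  -- The ordered product is multilinear even in a noncommutative algebra, so the sums over paths can
  -- be distributed with the order of the factors kept.
  rw [bmon, ← MultilinearMap.mkPiAlgebraFin_apply (R := Zq)]
  simp only [pathMatrix, Matrix.of_apply]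
  rw [MultilinearMap.map_sum_finset]
  refine Finset.sum_congr ?_ fun P _ => MultilinearMap.mkPiAlgebraFin_apply _
  ext P
  simp [Fintype.mem_piFinset]

/-- The family of paths through the levels given by a sequence of permutations. -/
def pathFamily {n m : ℕ} (u : Fin (m + 1) → Equiv.Perm (Fin n)) :
    Fin n → Fin (m + 1) → Fin n := fun a t => u t a

theorem pathFamily_injective {n m : ℕ} :
    Function.Injective (pathFamily (n := n) (m := m)) := fun _ _ h =>
  funext fun t => Equiv.ext fun a => congrFun (congrFun h a) t

/-- In each column the levels form a permutation, so exactly one path runs through any given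
weighted edge. -/
theorem sum_pathExp_pathFamily {n m : ℕ} (i : Fin m → Fin (n - 1))
    (u : Fin (m + 1) → Equiv.Perm (Fin n)) :
    ∑ a, pathExp i (pathFamily u a) = fun _ => 1 := by
  funext x
  rw [Finset.sum_apply]
  have : ∀ a, pathExp i (pathFamily u a) x = if a = (levelAt u x)⁻¹ x.lev then 1 else 0 := by
    intro a
    have : levelAt (pathFamily u a) x = levelAt u x a := by
      unfold levelAt; split_ifs <;> rfl
    rw [pathExp, this]
    simp only [Equiv.Perm.eq_inv_iff_eq]
  simp [this]

/-- If every weighted edge is used exactly once, every level is reached in every column, by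
induction from left to right; a surjective self-map of a finite set is a permutation. -/
theorem exists_pathFamily_eq {n m : ℕ} {i : Fin m → Fin (n - 1)}
    {P : Fin n → Fin (m + 1) → Fin n} (h0 : ∀ a, P a 0 = a)
    (hstep : ∀ a, ∀ j : Fin m, IsStep (i j) (P a j.castSucc) (P a j.succ))
    (hP : ∑ a, pathExp i (P a) = fun _ => 1) : ∃ u, pathFamily u = P := by
  have hsurj : ∀ t, Function.Surjective fun a => P a t := by
    intro t
    induction t using Fin.induction with
    | zero => exact fun a => ⟨a, h0 a⟩
    | succ j ih =>
      intro h
      by_cases hc : OnCross (i j) h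
      · by_contra hcon
        push Not at hcon
        -- A level on the crossing that no path reached would leave its right-hand edge with
        -- exponent 0.
        have := congrFun hP ⟨toLex (h, toLex (j, 1)), hc⟩
        rw [Finset.sum_apply, Finset.sum_eq_zero] at this
        · exact zero_ne_one this
        · exact fun a _ => if_neg (hcon a)
      -- Off the crossing, the path that was on this level one column earlier continues
      -- horizontally.
      · obtain ⟨a, rfl⟩ := ih h
        exact ⟨a, ((hstep a j).resolve_left fun hh => hc hh.1).2⟩
  refine ⟨fun t => Equiv.ofBijective _ ⟨Finite.injective_iff_surjective.2 (hsurj t), hsurj t⟩, ?_⟩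
  rfl

/-- On each side of each crossing one path holds the lower edge and one the upper, so a single pair
(a, b) can contribute, and it does exactly when the upper path a has the smaller source, which is
the condition defining `descent`. -/
theorem sum_zform_pathFamily {n m : ℕ} (i : Fin m → Fin (n - 1))
    (u : Fin (m + 1) → Equiv.Perm (Fin n)) :
    (∑ a, ∑ b, if a < b then zform (pathExp i (pathFamily u b)) (pathExp i (pathFamily u a))
      else 0) = coverExp i u := by
  have key : ∀ (w : Equiv.Perm (Fin n)) (k : Fin (n - 1)),
      (∑ a, ∑ b, if a < b then ((if w b = lo k then 1 else 0) * (if w a = hi k then 1 else 0) : ℤ)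
        else 0) = descent w k := by
    intro w k
    simp only [← Equiv.Perm.eq_inv_iff_eq]
    rw [Finset.sum_eq_single (w⁻¹ (hi k)), Finset.sum_eq_single (w⁻¹ (lo k))]
    · simp [descent]
    · intro b _ hb; rw [if_neg hb, zero_mul, ite_self]
    · simp
    · intro a _ ha; simp only [if_neg ha, mul_zero, ite_self, Finset.sum_const_zero]
    · simp
  have h1 : ∀ a b, zform (pathExp i (pathFamily u b)) (pathExp i (pathFamily u a)) =
      ∑ j, (((if u j.castSucc b = lo (i j) then 1 else 0) *
        (if u j.castSucc a = hi (i j) then 1 else 0) : ℤ) +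
        ((if u j.succ b = lo (i j) then 1 else 0) *
        (if u j.succ a = hi (i j) then 1 else 0) : ℤ)) := by
    intro a b
    refine Finset.sum_congr rfl fun j _ => ?_
    rw [Fin.sum_univ_two]
    simp only [pathExp, Nat.cast_ite, Nat.cast_one, Nat.cast_zero]
    rfl
  have h2 : ∀ (c : Prop) [Decidable c] (f : Fin m → ℤ),
      (if c then ∑ j, f j else 0) = ∑ j, if c then f j else 0 := by
    intro c _ f; split_ifs <;> simp
  simp only [h1, h2]
  -- With the sum over crossings outermost, `key` applies separately to the left and the right side
  -- of each crossing.
  simp_rw [Finset.sum_comm (t := (Finset.univ : Finset (Fin m)))]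
  rw [coverExp]
  refine Finset.sum_congr rfl fun j _ => ?_
  rw [← key, ← key, ← Finset.sum_add_distrib]
  refine Finset.sum_congr rfl fun a _ => ?_
  rw [← Finset.sum_add_distrib]
  refine Finset.sum_congr rfl fun b _ => ?_
  split_ifs <;> simp

-- The families of paths not of the form `pathFamily u` have a repeated or missing weighted edge, so
-- their monomial differs from z_G; the others are indexed injectively by coverings.
open Classical in
theorem zcoeff_bmon {n m : ℕ} (i : Fin m → Fin (n - 1)) (v : Equiv.Perm (Fin n)) :
    zcoeff i (bmon i v) =
      ∑ u : Fin (m + 1) → Equiv.Perm (Fin n) with IsCovering i 1 u ∧ u (Fin.last m) = v,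
        qh (coverExp i u) := by
  rw [bmon_eq_sum, zcoeff_sum]
  have hP : ∀ P : Fin n → Fin (m + 1) → Fin n, (∀ a, IsPath i a (v a) (P a)) →
      IsShift (List.ofFn fun a => pathWeight i (P a)).prod (∑ a, pathExp i (P a))
        (∑ a, ∑ b, if a < b then zform (pathExp i (P b)) (pathExp i (P a)) else 0) :=
    fun P h => IsShift.prod fun a => isShift_pathWeight (h a).2.2
  have hiff : ∀ u : Fin (m + 1) → Equiv.Perm (Fin n),
      (∀ a, IsPath i a (v a) (pathFamily u a)) ↔ IsCovering i 1 u ∧ u (Fin.last m) = v := by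
    intro u
    constructor
    · exact fun h => ⟨⟨Equiv.ext fun a => (h a).1, fun j a => (h a).2.2 j⟩,
        Equiv.ext fun a => (h a).2.1⟩
    · rintro ⟨⟨h1, h2⟩, rfl⟩ a
      exact ⟨congrArg (fun w : Equiv.Perm (Fin n) => w a) h1, rfl, fun j => h2 j a⟩
  symm
  refine Finset.sum_of_injOn pathFamily pathFamily_injective.injOn ?_ ?_ ?_
  · intro u hu
    simp only [Finset.coe_filter, Finset.mem_univ, true_and, Set.mem_ofPred_eq] at hu ⊢
    exact (hiff u).2 hu
  · intro P hPm hnot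
    have h := (Finset.mem_filter.1 hPm).2
    rw [(hP P h).zcoeff_eq, if_neg]
    intro hone
    obtain ⟨u, rfl⟩ := exists_pathFamily_eq (fun a => (h a).1) (fun a => (h a).2.2) hone
    exact hnot ⟨u, by simpa using (hiff u).1 h, rfl⟩
  · intro u hu
    have h := (hiff u).2 (Finset.mem_filter.1 hu).2
    rw [(hP _ h).zcoeff_eq, if_pos (sum_pathExp_pathFamily i u), sum_zform_pathFamily]

/-- The expansion of `(1 + T_{s_{i_1}}) ⋯ (1 + T_{s_{i_m}})` in the elements `T_w`. -/
theorem prod_one_add_heckeGen {n m : ℕ} (i : Fin m → Fin (n - 1)) :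
    (List.ofFn fun j => 1 + heckeGen (i j)).prod =
      ∑ w : Equiv.Perm (Fin n), (zcoeff i (bmon i w) * qh (-(len w : ℤ))) • heckeT w := by
  classical
  have h := heckeT_mul_prod i 1
  rw [heckeT_one, len_eq_inv, inv_one, Nat.cast_zero, neg_zero, qh_zero, one_smul, one_mul] at h
  -- Coverings are grouped by their last permutation, which is both the index of the resulting T_w
  -- and the sink assignment of the paths.
  rw [h, ← Finset.sum_fiberwise _ fun u => u (Fin.last m)]
  refine Finset.sum_congr rfl fun w _ => ?_
  rw [zcoeff_bmon, mul_smul, Finset.sum_smul, Finset.filter_filter]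
  refine Finset.sum_congr rfl fun u hu => ?_
  rw [(Finset.mem_filter.1 hu).2.2]

theorem sigma_immanant {n m : ℕ} (i : Fin m → Fin (n - 1)) (θ : Hecke n →ₗ[Zq] Zq) :
    sigma i (immanant θ) = ∑ w : Equiv.Perm (Fin n),
      θ (heckeT w) * qh (-(len w : ℤ)) * zcoeff i (bmon i w) := by
  simp only [immanant, map_sum, map_smul, sigma_xmon, smul_eq_mul]

end QImm

theorem theorem3p9 (n m : ℕ) (i : Fin m → Fin (n - 1))
    (θ : QImm.Hecke n →ₗ[QImm.Zq] QImm.Zq) :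
    θ (List.ofFn fun j => 1 + QImm.heckeGen (i j)).prod = QImm.sigma i (QImm.immanant θ) := by
  rw [QImm.sigma_immanant, QImm.prod_one_add_heckeGen, map_sum]
  refine Finset.sum_congr rfl fun w _ => ?_
  rw [map_smul, smul_eq_mul]
  ring
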